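/- Let $M$ be a Riemann surface with complex structure $J_M$ on its tangent spaces, and let $H=M\times\mathbb H^2$, where $\mathbb H^2$ is a right quaternionic vector space. Right multiplication by $\mathbb C=\mathbb R\oplus\mathbb R i\subset\mathbb H$ turns $H$ into $M\times\mathbb C^4$. For a $1$-form $\omega$ on $M$ put $*\omega(X)=\omega(J_MX)$. All bundles, sections and forms are smooth. For a (complex or quaternionic) line subbundle $V\subset H$ let $\pi_V:H\to H/V$ be the projection and let $\delta_V\in\Omega^1(\mathrm{Hom}(V,H/V))$ be defined by $\delta_V\phi=\pi_V d\phi$ for $\phi\in\Gamma(V)$; $V$ is immersed if $\delta_V(X)=0$ only for $X=0$. A complex line subbundle $E\subset H$, with $J_E$ the right multiplication by $i$, is a holomorphic curve in $\mathbb CP^3$ if $*\delta_E=\delta_EJ_E$. A complex quaternionic line subbundle is a pair $(L,J)$ of a quaternionic line subbundle $L\subset H$ and $J\in\Gamma(\mathrm{End}(L))$, quaternionic linear, with $J^2=-1$; it is a holomorphic curve in $\mathbb HP^1$ if $*\delta_L=\delta_LJ$. The twistor projection of $E$ is $(L,J)$ with $L=E\mathbb H=E\oplus Ej$ and $J$ the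 quaternionic linear extension of $J_E$ to $L$. For a bundle $V$ with complex structure $J$, $K\,\mathrm{End}_-(V)$ denotes the $1$-forms $\omega$ with values in the quaternionic linear endomorphisms of $V$ such that $*\omega=J\omega$ and $\omega J=-J\omega$. (i) Let $E\subset H$ be a complex line subbundle and $(L,J)$ its twistor projection. Then $(L,J)$ is a holomorphic curve if and only if $\tfrac12(\delta_E+*\delta_EJ_E)\in\Omega^1(\mathrm{Hom}(E,L/E))\subset\Omega^1(\mathrm{Hom}(E,H/E))$. Moreover, for every holomorphic curve $(L,J)$ in $\mathbb HP^1$ the formula $\tilde D\psi=\tfrac12(d\psi+*d(J\psi))$ defines an operator $\tilde D:\Gamma(L)\to\Omega^1(L)$, and its $(1,0)$-part $\tfrac12(\tilde D-J{*\tilde D})$ is the form $$A_L=\tfrac12(\tilde D+J\tilde DJ)\in\Gamma(K\,\mathrm{End}_-(L)).$$ (ii) If the twistor projection $(L,J)$ of $E$ is a holomorphic curve, then $\tfrac12(\delta_E+*\delta_EJ_E)=\pi_EA_L|_E$, and $\tfrac12(\delta_E+*\delta_EJ_E)=0$ if and only if $A_L=0$. A complex quaternionic line subbundle $(L,J)$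 is the twistor projection of a holomorphic curve $E$ in $\mathbb CP^3$ if and only if it is a holomorphic curve in $\mathbb HP^1$ with $A_L=0$. (iii) Let $(L,J)$ be an immersed holomorphic curve in $\mathbb HP^1$ with mean curvature sphere congruence $S$ and $J=S|_L$. Here $S\in\Gamma(\mathrm{End}(H))$ is the complex structure on $H$ ($S^2=-1$, quaternionic linear) with $SL=L$, $dS\,L\subset L$, $*\delta_L=\delta_L\circ S=S\circ\delta_L$ and $Q|_L=0$, where $Q=\tfrac14(S\,dS-*dS)$. Then $A=\tfrac14(S\,dS+*dS)\in\Gamma(K\,\mathrm{End}_-(H))$, and $A|_L=A_L$. -/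

import Mathlib

open scoped Quaternion Manifold ContDiff

/-- The quaternionic plane `ℍ²`. It is a right quaternionic vector space: `ℍᵐᵒᵖ` acts on it by
coordinatewise multiplication from the right. -/
abbrev H2 : Type := Fin 2 → ℍ[ℝ]

/-- The field `ℂ`, seen as the subfield of `ℍ` generated by `1` and `i`, acting on `ℍ²` by
multiplication from the right. This makes `ℍ²` into `ℂ⁴`. -/
def RightComplex : Type := ℂ

namespace RightComplex

noncomputable instance : Field RightComplex := inferInstanceAs (Field ℂ)

noncomputable instance : Algebra ℝ RightComplex := inferInstanceAs (Algebra ℝ ℂ)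

/-- The inclusion `ℂ → ℍ`, `x + i y ↦ x + i y`. -/
noncomputable def toQuaternion : RightComplex →ₐ[ℝ] ℍ[ℝ] := Quaternion.ofComplex

/-- The imaginary unit. -/
noncomputable def I : RightComplex := Complex.I

noncomputable instance : Module RightComplex H2 where
  smul z v := fun k => v k * toQuaternion z
  one_smul v := by funext k; change v k * toQuaternion 1 = _; simp
  mul_smul z w v := by
    funext k; change v k * toQuaternion (z * w) = v k * toQuaternion w * toQuaternion z
    rw [mul_comm, map_mul, mul_assoc]
  smul_zero z := by funext k; change (0 : ℍ[ℝ]) * _ = 0; simp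
  smul_add z v w := by funext k; exact add_mul (v k) (w k) (toQuaternion z)
  add_smul z w v := by
    funext k; change v k * toQuaternion (z + w) = v k * _ + v k * _; rw [map_add, mul_add]
  zero_smul v := by funext k; change v k * toQuaternion 0 = 0; simp

theorem smul_apply (z : RightComplex) (v : H2) (k : Fin 2) :
    (z • v) k = v k * toQuaternion z := rfl

theorem smul_eq_op_smul (z : RightComplex) (v : H2) :
    z • v = MulOpposite.op (toQuaternion z) • v := rfl

instance : IsScalarTower ℝ RightComplex H2 := ⟨fun r z v => by
  funext k; rw [Pi.smul_apply, smul_apply, smul_apply, map_smul, mul_smul_comm]⟩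

instance : SMulCommClass RightComplex ℝ H2 := ⟨fun z r v => by
  funext k; simp [smul_apply]⟩

theorem I_mul_I : I * I = -1 := Complex.I_mul_I

end RightComplex

/-- `R` acts on `ℍ²` from the right through quaternions. The two cases are `R = ℍᵐᵒᵖ` and
`R = RightComplex`. -/
class ActsFromRight (R : Type) [Ring R] [Algebra ℝ R] [Module R H2] : Prop where
  exists_toQuaternion : ∃ ι : R →ₗ[ℝ] ℍ[ℝ], ∀ (c : R) (v : H2) (k : Fin 2), (c • v) k = v k * ι c

instance : ActsFromRight RightComplex :=
  ⟨RightComplex.toQuaternion.toLinearMap, fun _ _ _ => rfl⟩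

instance : ActsFromRight ℍ[ℝ]ᵐᵒᵖ :=
  ⟨(MulOpposite.opLinearEquiv ℝ).symm.toLinearMap, fun _ _ _ => rfl⟩

section Surface

variable {M : Type*} [TopologicalSpace M] [ChartedSpace ℂ M]

/-- The real tangent space of a Riemann surface `M` at `p`. -/
abbrev TSpace (p : M) : Type := TangentSpace 𝓘(ℝ, ℂ) p

/-- The complex structure of the tangent space: multiplication by `i`. -/
noncomputable def rot (p : M) : TSpace p →ₗ[ℝ] TSpace p :=
  (LinearMap.mulLeft ℝ Complex.I : ℂ →ₗ[ℝ] ℂ)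

/-- The differential at `p` of a map from `M` to a real normed space. -/
noncomputable def diff {F : Type*} [NormedAddCommGroup F] [NormedSpace ℝ F] (f : M → F) (p : M) :
    TSpace p →ₗ[ℝ] F :=
  (mfderiv 𝓘(ℝ, ℂ) 𝓘(ℝ, F) f p : TSpace p →L[ℝ] F).toLinearMap

/-- The coordinate vector field in the constant direction `w` of the chart around `p₀`,
a vector field on the domain of that chart. -/
noncomputable def coordField (p₀ : M) (w : ℂ) (q : M) : TSpace q :=
  (mfderiv 𝓘(ℝ, ℂ) 𝓘(ℝ, ℂ) (chartAt ℂ p₀).symm (chartAt ℂ p₀ q) : ℂ → ℂ) w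

/-- Smoothness on `U` of a 1-form on `M` with values in a normed space: its components in all
charts are smooth. -/
def SmoothFormOn {F : Type*} [NormedAddCommGroup F] [NormedSpace ℝ F] (U : Set M)
    (η : ∀ p : M, TSpace p →ₗ[ℝ] F) : Prop :=
  ∀ (p₀ : M) (w : ℂ), ContMDiffOn 𝓘(ℝ, ℂ) 𝓘(ℝ, F) ∞ (fun q => η q (coordField p₀ w q))
    (U ∩ (chartAt ℂ p₀).source)

end Surface

/-- A smooth `R`-line subbundle of the product bundle `M × ℍ²`: a family of `R`-subspaces
that is spanned, locally, by a smooth section without zeros. -/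
structure LineSubbundle (R : Type) [Ring R] [Module R H2]
    (M : Type*) [TopologicalSpace M] [ChartedSpace ℂ M] where
  fiber : M → Submodule R H2
  exists_frame : ∀ p : M, ∃ U : Set M, IsOpen U ∧ p ∈ U ∧ ∃ σ : ∀ q, fiber q,
    ContMDiffOn 𝓘(ℝ, ℂ) 𝓘(ℝ, H2) ∞ (fun q => (σ q : H2)) U ∧
      ∀ q ∈ U, (σ q : H2) ≠ 0 ∧ fiber q = Submodule.span R {(σ q : H2)}

namespace LineSubbundle

variable {M : Type*} [TopologicalSpace M] [ChartedSpace ℂ M]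

/-- `φ` is a smooth section of `E` over the open set `U`; its values off `U` are irrelevant. -/
def SmoothSectionOn {R : Type} [Ring R] [Module R H2] (E : LineSubbundle R M) (U : Set M)
    (φ : ∀ q, E.fiber q) : Prop :=
  ContMDiffOn 𝓘(ℝ, ℂ) 𝓘(ℝ, H2) ∞ (fun q => (φ q : H2)) U

theorem mdifferentiableAt_of_section {R : Type} [Ring R] [Module R H2]
    {E : LineSubbundle R M} {U : Set M} (hU : IsOpen U)
    {φ : ∀ q, E.fiber q} (hφ : E.SmoothSectionOn U φ) {p : M} (hp : p ∈ U) :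
    MDifferentiableAt 𝓘(ℝ, ℂ) 𝓘(ℝ, H2) (fun q => (φ q : H2)) p :=
  (hφ.contMDiffAt (hU.mem_nhds hp)).mdifferentiableAt (by simp)

section Delta

variable {R : Type} [Ring R] [Algebra ℝ R] [Module R H2]

theorem exists_coord_ne_zero {v : H2} (hv : v ≠ 0) : ∃ k, v k ≠ 0 := by
  by_contra! h
  exact hv (funext h)

theorem mdifferentiableAt_coord {f : M → H2} {p : M}
    (hf : MDifferentiableAt 𝓘(ℝ, ℂ) 𝓘(ℝ, H2) f p) (k : Fin 2) :
    HasMFDerivAt 𝓘(ℝ, ℂ) 𝓘(ℝ, ℍ[ℝ]) (fun q => f q k) p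
      ((ContinuousLinearMap.proj (R := ℝ) (φ := fun _ : Fin 2 => ℍ[ℝ]) k).comp
        (mfderiv 𝓘(ℝ, ℂ) 𝓘(ℝ, H2) f p : TSpace p →L[ℝ] H2)) := by
  have h1 := (ContinuousLinearMap.proj (R := ℝ) (φ := fun _ : Fin 2 => ℍ[ℝ]) k).hasFDerivAt
    (x := f p)
  exact HasMFDerivAt.comp (I' := 𝓘(ℝ, H2)) p h1.hasMFDerivAt hf.hasMFDerivAt

/-- The differential of a section that vanishes at `p` takes values in the fibre at `p`. -/
theorem diff_mem_of_eq_zero [ActsFromRight R] (E : LineSubbundle R M) {U : Set M} (hU : IsOpen U)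
    {φ : ∀ q, E.fiber q} (hφ : E.SmoothSectionOn U φ) {p : M} (hp : p ∈ U)
    (h0 : (φ p : H2) = 0) (X : TSpace p) :
    diff (fun q => (φ q : H2)) p X ∈ E.fiber p := by
  obtain ⟨ι, hι⟩ := ActsFromRight.exists_toQuaternion (R := R)
  obtain ⟨V, hV, hpV, σ, hσ, hspan⟩ := E.exists_frame p
  obtain ⟨k, hk⟩ := exists_coord_ne_zero (hspan p hpV).1
  have dσ := mdifferentiableAt_of_section (E := E) hV hσ hpV
  have dφ := mdifferentiableAt_of_section hU hφ hp
  have hσk := (mdifferentiableAt_coord dσ k)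
  have hφk := (mdifferentiableAt_coord dφ k)
  set b : M → ℍ[ℝ] := (fun q => ((σ q : H2) k))⁻¹ * (fun q => (φ q : H2) k) with hb
  have db : MDifferentiableAt 𝓘(ℝ, ℂ) 𝓘(ℝ, ℍ[ℝ]) b p :=
    ((hσk.mdifferentiableAt.inv hk).hasMFDerivAt.mul' hφk).mdifferentiableAt
  have hb0 : b p = 0 := by simp [hb, h0]
  have hne : ∀ᶠ q in nhds p, (σ q : H2) k ≠ 0 :=
    hσk.mdifferentiableAt.continuousAt.eventually_ne hk
  have key : ∀ᶠ q in nhds p, ∃ c : R, b q = ι c ∧ ∀ l, (φ q : H2) l = (σ q : H2) l * b q := by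
    filter_upwards [hne, hV.mem_nhds hpV] with q hq hqV
    obtain ⟨c, hc⟩ := Submodule.mem_span_singleton.1 ((hspan q hqV).2.le (φ q).2)
    have hl : ∀ l, (φ q : H2) l = (σ q : H2) l * ι c := fun l => by rw [← hc, hι]
    have hbc : b q = ι c := by
      simp only [hb, Pi.mul_apply, Pi.inv_apply, hl k]
      rw [← mul_assoc, inv_mul_cancel₀ hq, one_mul]
    exact ⟨c, hbc, fun l => by rw [hbc, hl]⟩
  -- the derivative of `b` stays in the range of `ι`
  set b' : TSpace p →L[ℝ] ℍ[ℝ] := mfderiv 𝓘(ℝ, ℂ) 𝓘(ℝ, ℍ[ℝ]) b p with hb'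
  have hrange : b' X ∈ LinearMap.range ι := by
    by_contra hX
    obtain ⟨f, hf, hker⟩ := Submodule.exists_le_ker_of_notMem hX
    apply hf
    have h1 : HasMFDerivAt 𝓘(ℝ, ℂ) 𝓘(ℝ, ℝ) (f.toContinuousLinearMap ∘ b) p
        (f.toContinuousLinearMap.comp b') :=
      HasMFDerivAt.comp (I' := 𝓘(ℝ, ℍ[ℝ])) p
        (f.toContinuousLinearMap.hasFDerivAt (x := b p)).hasMFDerivAt db.hasMFDerivAt
    have h2 : HasMFDerivAt 𝓘(ℝ, ℂ) 𝓘(ℝ, ℝ) (f.toContinuousLinearMap ∘ b) p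
        (0 : TSpace p →L[ℝ] ℝ) :=
      (hasMFDerivAt_const (I := 𝓘(ℝ, ℂ)) (I' := 𝓘(ℝ, ℝ)) (0 : ℝ) p).congr_of_eventuallyEq (by
        filter_upwards [key] with q hq
        obtain ⟨c, hc, _⟩ := hq
        exact (congrArg f hc).trans (hker ⟨c, rfl⟩))
    exact congrArg (fun T : TSpace p →L[ℝ] ℝ => T X) (hasMFDerivAt_unique h1 h2)
  obtain ⟨c, hc⟩ := hrange
  have hfin : diff (fun q => (φ q : H2)) p X = c • (σ p : H2) := by
    funext l
    have h1 := (mdifferentiableAt_coord dσ l).mul' db.hasMFDerivAt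
    have h2 := h1.congr_of_eventuallyEq (f₁ := fun q => (φ q : H2) l)
      (by filter_upwards [key] with q hq; obtain ⟨_, _, h⟩ := hq; exact h l)
    have h3 := hasMFDerivAt_unique (mdifferentiableAt_coord dφ l) h2
    have h4 := congrArg (fun T : TSpace p →L[ℝ] ℍ[ℝ] => T X) h3
    rw [hι, hc]
    refine h4.trans ?_
    change (σ p : H2) l * b' X + _ * b p = _
    rw [hb0, mul_zero, add_zero]
  rw [hfin]
  exact (E.fiber p).smul_mem c (σ p).2

theorem exists_delta [ActsFromRight R] [IsScalarTower ℝ R H2] [SMulCommClass R ℝ H2]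
    (E : LineSubbundle R M) :
    ∃ δ : ∀ p : M, TSpace p →ₗ[ℝ] (E.fiber p →ₗ[R] H2 ⧸ E.fiber p),
      ∀ (U : Set M) (φ : ∀ q, E.fiber q), IsOpen U → E.SmoothSectionOn U φ → ∀ p ∈ U,
        ∀ X : TSpace p,
          δ p X (φ p) = (E.fiber p).mkQ (diff (fun q => (φ q : H2)) p X) := by
  obtain ⟨ι, hι⟩ := ActsFromRight.exists_toQuaternion (R := R)
  have act : ∀ c : R, ∃ T : H2 →L[ℝ] H2, ∀ v, T v = c • v := fun c =>
    ⟨LinearMap.toContinuousLinearMap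
      { toFun := fun v => c • v
        map_add' := smul_add c
        map_smul' := fun r v => smul_comm c r v }, fun v => rfl⟩
  have hsmul : ∀ (c : R) (f : M → H2) (p : M), MDifferentiableAt 𝓘(ℝ, ℂ) 𝓘(ℝ, H2) f p →
      HasMFDerivAt 𝓘(ℝ, ℂ) 𝓘(ℝ, H2) (fun q => c • f q) p
        ((act c).choose.comp (mfderiv 𝓘(ℝ, ℂ) 𝓘(ℝ, H2) f p : TSpace p →L[ℝ] H2)) := by
    intro c f p hf
    have h : (fun q => c • f q) = (act c).choose ∘ f := by
      funext q; exact ((act c).choose_spec (f q)).symm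
    rw [h]
    exact HasMFDerivAt.comp (I' := 𝓘(ℝ, H2)) p
      ((act c).choose.hasFDerivAt (x := f p)).hasMFDerivAt hf.hasMFDerivAt
  have uniq : ∀ (p : M) (U V : Set M) (φ ψ : ∀ q, E.fiber q), IsOpen U → IsOpen V → p ∈ U →
      p ∈ V → E.SmoothSectionOn U φ → E.SmoothSectionOn V ψ → φ p = ψ p → ∀ X : TSpace p,
      (E.fiber p).mkQ (diff (fun q => (φ q : H2)) p X) =
        (E.fiber p).mkQ (diff (fun q => (ψ q : H2)) p X) := by
    intro p U V φ ψ hU hV hpU hpV hφ hψ h X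
    have hs : E.SmoothSectionOn (U ∩ V) (fun q => φ q - ψ q) :=
      (hφ.mono Set.inter_subset_left).sub (hψ.mono Set.inter_subset_right)
    have hd := E.diff_mem_of_eq_zero (hU.inter hV) hs ⟨hpU, hpV⟩ (by simp [h]) X
    have he : diff (fun q => ((φ q - ψ q : E.fiber q) : H2)) p X =
        diff (fun q => (φ q : H2)) p X - diff (fun q => (ψ q : H2)) p X := by
      have := ((mdifferentiableAt_of_section hU hφ hpU).hasMFDerivAt.sub
        (mdifferentiableAt_of_section hV hψ hpV).hasMFDerivAt).mfderiv
      exact congrArg (fun T : TSpace p →L[ℝ] H2 => T X) this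
    rw [he] at hd
    exact (Submodule.Quotient.eq _).2 hd
  have hex : ∀ p (v : E.fiber p), ∃ φ : ∀ q, E.fiber q, ∃ U, IsOpen U ∧ p ∈ U ∧
      E.SmoothSectionOn U φ ∧ φ p = v := by
    intro p v
    obtain ⟨V, hV, hpV, σ, hσ, hspan⟩ := E.exists_frame p
    obtain ⟨c, hc⟩ := Submodule.mem_span_singleton.1 ((hspan p hpV).2.le v.2)
    refine ⟨fun q => c • σ q, V, hV, hpV, ?_, Subtype.ext hc⟩
    have h := (act c).choose.contDiff.contMDiff.comp_contMDiffOn hσ (n := ∞)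
    refine h.congr fun q _ => ?_
    exact ((act c).choose_spec _).symm
  choose φ U hU hpU hφ hv using hex
  refine ⟨fun p =>
    { toFun := fun X =>
        { toFun := fun v => (E.fiber p).mkQ (diff (fun q => (φ p v q : H2)) p X)
          map_add' := fun v w => ?_
          map_smul' := fun c v => ?_ }
      map_add' := fun X Y => ?_
      map_smul' := fun r X => ?_ }, fun V ψ hV hψ p hp X => ?_⟩
  · have hs : E.SmoothSectionOn (U p v ∩ U p w) (fun q => φ p v q + φ p w q) :=
      ((hφ p v).mono Set.inter_subset_left).add ((hφ p w).mono Set.inter_subset_right)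
    rw [uniq p _ _ (φ p (v + w)) _ (hU p _) ((hU p v).inter (hU p w)) (hpU p _)
      ⟨hpU p v, hpU p w⟩ (hφ p _) hs (by simp [hv]) X, ← map_add]
    congr 1
    have := ((mdifferentiableAt_of_section (hU p v) (hφ p v) (hpU p v)).hasMFDerivAt.add
        (mdifferentiableAt_of_section (hU p w) (hφ p w) (hpU p w)).hasMFDerivAt).mfderiv
    exact congrArg (fun T : TSpace p →L[ℝ] H2 => T X) this
  · have hd := mdifferentiableAt_of_section (hU p v) (hφ p v) (hpU p v)
    have hs : E.SmoothSectionOn (U p v) (fun q => c • φ p v q) := by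
      have h := (act c).choose.contDiff.contMDiff.comp_contMDiffOn (hφ p v) (n := ∞)
      refine h.congr fun q _ => ?_
      exact ((act c).choose_spec _).symm
    rw [uniq p _ _ (φ p (c • v)) _ (hU p _) (hU p v) (hpU p _) (hpU p v) (hφ p _) hs
      (by simp [hv]) X, RingHom.id_apply, ← map_smul]
    congr 1
    refine (congrArg (fun T : TSpace p →L[ℝ] H2 => T X) (hsmul c _ p hd).mfderiv).trans ?_
    exact (act c).choose_spec _
  · ext v; simp
  · ext v
    simp only [map_smul, LinearMap.coe_mk, AddHom.coe_mk, LinearMap.smul_apply, RingHom.id_apply]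
    rfl
  · exact uniq p _ _ _ _ (hU p _) hV (hpU p _) hp (hφ p _) hψ (hv p _) X

/-- The derivative `δ_E ∈ Ω¹(Hom(E, H/E))` of a line subbundle `E ⊂ H = M × ℍ²`, i.e. the
form with `δ_E φ = π_E dφ` for all (local) smooth sections `φ` of `E`. -/
noncomputable def delta [ActsFromRight R] [IsScalarTower ℝ R H2] [SMulCommClass R ℝ H2]
    (E : LineSubbundle R M) (p : M) : TSpace p →ₗ[ℝ] (E.fiber p →ₗ[R] H2 ⧸ E.fiber p) :=
  E.exists_delta.choose p

theorem delta_apply [ActsFromRight R] [IsScalarTower ℝ R H2] [SMulCommClass R ℝ H2]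
    (E : LineSubbundle R M) {U : Set M} {φ : ∀ q, E.fiber q} (hU : IsOpen U)
    (hφ : E.SmoothSectionOn U φ) {p : M} (hp : p ∈ U) (X : TSpace p) :
    E.delta p X (φ p) = (E.fiber p).mkQ (diff (fun q => (φ q : H2)) p X) :=
  E.exists_delta.choose_spec U φ hU hφ p hp X

end Delta
end LineSubbundle

/-- A complex quaternionic line subbundle `(L, J)` of `M × ℍ²`: a quaternionic line subbundle
with a smooth quaternionic linear endomorphism `J` of square `-1`. -/
structure ComplexQuaternionicLine (M : Type*) [TopologicalSpace M] [ChartedSpace ℂ M] extends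
    LineSubbundle ℍ[ℝ]ᵐᵒᵖ M where
  J : ∀ p, fiber p →ₗ[ℍ[ℝ]ᵐᵒᵖ] fiber p
  J_sq : ∀ p v, J p (J p v) = -v
  J_smooth : ∀ (U : Set M) (ψ : ∀ q, fiber q), IsOpen U →
    toLineSubbundle.SmoothSectionOn U ψ →
      toLineSubbundle.SmoothSectionOn U (fun q => J q (ψ q))

namespace LineSubbundle

variable {M : Type*} [TopologicalSpace M] [ChartedSpace ℂ M]

/-- The quaternionic line bundle `L = Eℍ = E ⊕ Ej` of a complex line bundle `E`. -/
noncomputable def quaternionicSpan (E : LineSubbundle RightComplex M) : LineSubbundle ℍ[ℝ]ᵐᵒᵖ M where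
  fiber p := Submodule.span ℍ[ℝ]ᵐᵒᵖ (E.fiber p : Set H2)
  exists_frame p := by
    obtain ⟨U, hU, hp, σ, hσ, h⟩ := E.exists_frame p
    refine ⟨U, hU, hp, fun q => ⟨σ q, Submodule.subset_span (σ q).2⟩, hσ, fun q hq =>
      ⟨(h q hq).1, le_antisymm (Submodule.span_le.2 fun v hv => ?_)
        (Submodule.span_le.2 (Set.singleton_subset_iff.2 (Submodule.subset_span (σ q).2)))⟩⟩
    obtain ⟨c, rfl⟩ := Submodule.mem_span_singleton.1 ((h q hq).2.le hv)
    exact Submodule.mem_span_singleton.2 ⟨MulOpposite.op (RightComplex.toQuaternion c), rfl⟩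

theorem mem_quaternionicSpan (E : LineSubbundle RightComplex M) {p : M} (v : E.fiber p) :
    (v : H2) ∈ E.quaternionicSpan.fiber p :=
  Submodule.subset_span v.2

/-- The inclusion `E ⊂ L = Eℍ`. -/
noncomputable def incl (E : LineSubbundle RightComplex M) {p : M} (v : E.fiber p) :
    E.quaternionicSpan.fiber p :=
  ⟨v, E.mem_quaternionicSpan v⟩

/-- Right multiplication by `i` on a complex line extends to a quaternionic linear endomorphism
of the quaternionic line which it spans. -/
theorem exists_extension (E : LineSubbundle RightComplex M) (p : M) :
    ∃ J : E.quaternionicSpan.fiber p →ₗ[ℍ[ℝ]ᵐᵒᵖ] E.quaternionicSpan.fiber p,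
      ∀ v : E.fiber p, J (E.incl v) = E.incl (RightComplex.I • v) := by
  obtain ⟨U, hU, hp, σ, hσ, h⟩ := E.exists_frame p
  obtain ⟨hne, hspan⟩ := h p hp
  have hL : E.quaternionicSpan.fiber p = Submodule.span ℍ[ℝ]ᵐᵒᵖ {(σ p : H2)} := by
    refine le_antisymm (Submodule.span_le.2 fun v hv => ?_)
      (Submodule.span_le.2 (Set.singleton_subset_iff.2 (Submodule.subset_span (σ p).2)))
    obtain ⟨c, rfl⟩ := Submodule.mem_span_singleton.1 (hspan.le hv)
    exact Submodule.mem_span_singleton.2 ⟨MulOpposite.op (RightComplex.toQuaternion c), rfl⟩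
  let e := (LinearEquiv.toSpanNonzeroSingleton ℍ[ℝ]ᵐᵒᵖ H2 (σ p : H2) hne)
  let J := (LinearMap.toSpanSingleton ℍ[ℝ]ᵐᵒᵖ (E.quaternionicSpan.fiber p)
    (E.incl (RightComplex.I • σ p))).comp
      (e.symm.toLinearMap.comp (LinearEquiv.ofEq _ _ hL).toLinearMap)
  refine ⟨J, fun v => ?_⟩
  obtain ⟨c, hc⟩ := Submodule.mem_span_singleton.1 (hspan.le v.2)
  obtain rfl : c • σ p = v := Subtype.ext hc
  have he : LinearEquiv.ofEq _ _ hL (E.incl (c • σ p)) =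
      e (MulOpposite.op (RightComplex.toQuaternion c)) := Subtype.ext rfl
  change LinearMap.toSpanSingleton ℍ[ℝ]ᵐᵒᵖ (E.quaternionicSpan.fiber p)
    (E.incl (RightComplex.I • σ p)) (e.symm (LinearEquiv.ofEq _ _ hL (E.incl (c • σ p)))) = _
  rw [he, LinearEquiv.symm_apply_apply, LinearMap.toSpanSingleton_apply]
  apply Subtype.ext
  change c • (RightComplex.I • (σ p : H2)) = RightComplex.I • (c • (σ p : H2))
  exact smul_comm _ _ _

/-- The extension of `J_E` to `L = Eℍ`; it is right multiplication by `-i` on `Ej`. -/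
noncomputable def twistorJ (E : LineSubbundle RightComplex M) (p : M) :
    E.quaternionicSpan.fiber p →ₗ[ℍ[ℝ]ᵐᵒᵖ] E.quaternionicSpan.fiber p :=
  (E.exists_extension p).choose

theorem twistorJ_incl (E : LineSubbundle RightComplex M) {p : M} (v : E.fiber p) :
    E.twistorJ p (E.incl v) = E.incl (RightComplex.I • v) :=
  (E.exists_extension p).choose_spec v

theorem contMDiffOn_coord {f : M → H2} {U : Set M}
    (hf : ContMDiffOn 𝓘(ℝ, ℂ) 𝓘(ℝ, H2) ∞ f U) (k : Fin 2) :
    ContMDiffOn 𝓘(ℝ, ℂ) 𝓘(ℝ, ℍ[ℝ]) ∞ (fun q => f q k) U :=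
  (contMDiffOn_pi_space.1 hf) k

theorem contMDiffAt_mul_quaternion {f g : M → ℍ[ℝ]} {p : M}
    (hf : ContMDiffAt 𝓘(ℝ, ℂ) 𝓘(ℝ, ℍ[ℝ]) ∞ f p) (hg : ContMDiffAt 𝓘(ℝ, ℂ) 𝓘(ℝ, ℍ[ℝ]) ∞ g p) :
    ContMDiffAt 𝓘(ℝ, ℂ) 𝓘(ℝ, ℍ[ℝ]) ∞ (fun q => f q * g q) p :=
  ContDiffAt.comp_contMDiffAt (g := fun x : ℍ[ℝ] × ℍ[ℝ] => x.1 * x.2) (f := fun q => (f q, g q))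
    contDiff_mul.contDiffAt (hf.prodMk_space hg)

/-- The twistor projection `(L, J)` of a complex line subbundle `E ⊂ M × ℍ² = M × ℂ⁴`. -/
noncomputable def twistorProjection (E : LineSubbundle RightComplex M) :
    ComplexQuaternionicLine M where
  toLineSubbundle := E.quaternionicSpan
  J := E.twistorJ
  J_sq p v := by
    obtain ⟨v, hv⟩ := v
    refine Submodule.span_induction (p := fun v hv => E.twistorJ p (E.twistorJ p ⟨v, hv⟩) =
      -(⟨v, hv⟩ : E.quaternionicSpan.fiber p)) ?_ ?_ ?_ ?_ hv
    · intro x hx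
      have h := E.twistorJ_incl ⟨x, hx⟩
      change E.twistorJ p (E.twistorJ p (E.incl ⟨x, hx⟩)) = _
      rw [h, E.twistorJ_incl, smul_smul, RightComplex.I_mul_I]
      apply Subtype.ext
      change ((-1 : RightComplex) • x) = -x
      simp
    · exact (by simp : E.twistorJ p (E.twistorJ p 0) = -0)
    · intro x y hx hy h1 h2
      have : (⟨x + y, add_mem hx hy⟩ : E.quaternionicSpan.fiber p) = ⟨x, hx⟩ + ⟨y, hy⟩ := rfl
      rw [this, map_add, map_add, h1, h2, neg_add]
    · intro c x hx h1
      have : (⟨c • x, Submodule.smul_mem _ c hx⟩ : E.quaternionicSpan.fiber p) = c • ⟨x, hx⟩ := rfl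
      rw [this, map_smul, map_smul, h1, smul_neg]
  J_smooth U ψ hU hψ := by
    intro p hp
    obtain ⟨V, hV, hpV, σ, hσ, h⟩ := E.exists_frame p
    obtain ⟨k, hk⟩ := exists_coord_ne_zero (h p hpV).1
    have hσp : ∀ l, ContMDiffAt 𝓘(ℝ, ℂ) 𝓘(ℝ, ℍ[ℝ]) ∞ (fun q => (σ q : H2) l) p := fun l =>
      (contMDiffOn_coord hσ l).contMDiffAt (hV.mem_nhds hpV)
    have hψp : ContMDiffAt 𝓘(ℝ, ℂ) 𝓘(ℝ, ℍ[ℝ]) ∞ (fun q => (ψ q : H2) k) p :=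
      (contMDiffOn_coord hψ k).contMDiffAt (hU.mem_nhds hp)
    have hinv : ContDiffAt ℝ ∞ (fun x : ℍ[ℝ] => x⁻¹) ((σ p : H2) k) := by
      have := contDiffAt_ringInverse ℝ (n := ∞) (Units.mk0 _ hk)
      simpa [Ring.inverse_eq_inv'] using this
    have hb : ContMDiffAt 𝓘(ℝ, ℂ) 𝓘(ℝ, ℍ[ℝ]) ∞ (fun q => ((σ q : H2) k)⁻¹ * (ψ q : H2) k) p :=
      contMDiffAt_mul_quaternion (ContDiffAt.comp_contMDiffAt (g := fun x : ℍ[ℝ] => x⁻¹)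
        (f := fun q => (σ q : H2) k) hinv (hσp k)) hψp
    refine ContMDiffAt.contMDiffWithinAt ?_
    have hJ : ContMDiffAt 𝓘(ℝ, ℂ) 𝓘(ℝ, H2) ∞ (fun q => fun l => (σ q : H2) l *
        RightComplex.toQuaternion RightComplex.I * (((σ q : H2) k)⁻¹ * (ψ q : H2) k)) p :=
      contMDiffAt_pi_space.2 fun l =>
        contMDiffAt_mul_quaternion (contMDiffAt_mul_quaternion (hσp l) contMDiffAt_const) hb
    refine hJ.congr_of_eventuallyEq ?_
    filter_upwards [hV.mem_nhds hpV, (hσp k).continuousAt.eventually_ne hk] with q hq hqk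
    have hm : (ψ q : H2) ∈ Submodule.span ℍ[ℝ]ᵐᵒᵖ {(σ q : H2)} := by
      refine (Submodule.span_le.2 fun v hv => ?_ :
        E.quaternionicSpan.fiber q ≤ Submodule.span ℍ[ℝ]ᵐᵒᵖ {(σ q : H2)}) (ψ q).2
      obtain ⟨c, rfl⟩ := Submodule.mem_span_singleton.1 ((h q hq).2.le hv)
      exact Submodule.mem_span_singleton.2 ⟨MulOpposite.op (RightComplex.toQuaternion c), rfl⟩
    obtain ⟨c, hc⟩ := Submodule.mem_span_singleton.1 hm
    have hψq : ψ q = c • E.incl (σ q) := Subtype.ext hc.symm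
    rw [hψq, map_smul, E.twistorJ_incl]
    funext l
    change (σ q : H2) l * RightComplex.toQuaternion RightComplex.I * c.unop =
      (σ q : H2) l * RightComplex.toQuaternion RightComplex.I *
        (((σ q : H2) k)⁻¹ * ((σ q : H2) k * c.unop))
    rw [← mul_assoc (((σ q : H2) k)⁻¹), inv_mul_cancel₀ hqk, one_mul]

/-- `E` is a holomorphic curve in `ℂP³`: `*δ_E = δ_E J_E`, where `*` is precomposition with the
complex structure of the tangent spaces and `J_E` is multiplication by `i`. -/
def IsHolomorphicCurve (E : LineSubbundle RightComplex M) : Prop :=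
  ∀ (p : M) (X : TSpace p) (v : E.fiber p),
    E.delta p (rot p X) v = E.delta p X (RightComplex.I • v)

/-- The form `½ (δ_E + *δ_E J_E) ∈ Ω¹(Hom(E, H/E))`. -/
noncomputable def halfDelta (E : LineSubbundle RightComplex M) (p : M) :
    TSpace p →ₗ[ℝ] (E.fiber p →ₗ[RightComplex] H2 ⧸ E.fiber p) where
  toFun X := (1 / 2 : ℝ) • (E.delta p X +
    (E.delta p (rot p X)).comp (RightComplex.I • LinearMap.id))
  map_add' X Y := by
    simp only [map_add, LinearMap.add_comp, smul_add]; abel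
  map_smul' r X := by
    ext v
    simp only [map_smul, LinearMap.smul_apply, LinearMap.add_apply, LinearMap.comp_apply,
      RingHom.id_apply, smul_add, smul_comm r (1 / 2 : ℝ),
      smul_comm RightComplex.I r]

/-- A quaternionic line subbundle of `M × ℍ²` is immersed: its derivative is injective. -/
def IsImmersed (L : LineSubbundle ℍ[ℝ]ᵐᵒᵖ M) : Prop :=
  ∀ (p : M) (X : TSpace p), L.delta p X = 0 → X = 0

end LineSubbundle

namespace ComplexQuaternionicLine

variable {M : Type*} [TopologicalSpace M] [ChartedSpace ℂ M]

/-- `(L, J)` is a holomorphic curve in `ℍP¹`: `*δ_L = δ_L J`. -/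
def IsHolomorphicCurve (L : ComplexQuaternionicLine M) : Prop :=
  ∀ (p : M) (X : TSpace p) (v : L.fiber p),
    L.delta p (rot p X) v = L.delta p X (L.J p v)

/-- The operator `D̃ψ = ½ (dψ + *d(Jψ))` on sections of `L`. Its values are, a priori, forms
with values in `ℍ²`. -/
noncomputable def dTilde (L : ComplexQuaternionicLine M) (ψ : ∀ q, L.fiber q) (p : M) :
    TSpace p →ₗ[ℝ] H2 :=
  (1 / 2 : ℝ) • (diff (fun q => (ψ q : H2)) p +
    (diff (fun q => (L.J q (ψ q) : H2)) p).comp (rot p))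

/-- 1-forms on `M` with values in `End(L)` (no smoothness required). -/
abbrev EndForm (L : ComplexQuaternionicLine M) : Type _ :=
  ∀ p : M, TSpace p →ₗ[ℝ] (L.fiber p →ₗ[ℍ[ℝ]ᵐᵒᵖ] L.fiber p)

/-- The form `A` is `A_L = ½ (D̃ + J D̃ J)`, as operators on (local) smooth sections of `L`.
This includes that `D̃ J ψ` has values in `L`, so that `J` can be applied to it. -/
def IsAL (L : ComplexQuaternionicLine M) (A : L.EndForm) : Prop :=
  ∀ (U : Set M) (ψ : ∀ q, L.fiber q), IsOpen U → L.SmoothSectionOn U ψ →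
    ∀ p ∈ U, ∀ X : TSpace p, ∃ h : L.dTilde (fun q => L.J q (ψ q)) p X ∈ L.fiber p,
      (A p X (ψ p) : H2) = (1 / 2 : ℝ) • (L.dTilde ψ p X + (L.J p ⟨_, h⟩ : H2))

/-- The form `A` is the `(1,0)`-part `½ (D̃ - J *D̃)` of `D̃`. -/
def IsOneZeroPart (L : ComplexQuaternionicLine M) (A : L.EndForm) : Prop :=
  ∀ (U : Set M) (ψ : ∀ q, L.fiber q), IsOpen U → L.SmoothSectionOn U ψ →
    ∀ p ∈ U, ∀ X : TSpace p, ∃ h : L.dTilde ψ p (rot p X) ∈ L.fiber p,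
      (A p X (ψ p) : H2) = (1 / 2 : ℝ) • (L.dTilde ψ p X - (L.J p ⟨_, h⟩ : H2))

/-- `A ∈ Γ(K End₋(L))`: the form `A` is smooth, `*A = J A`, and `A J = - J A`. -/
structure IsKEndMinus (L : ComplexQuaternionicLine M) (A : L.EndForm) : Prop where
  smooth : ∀ (U : Set M) (ψ : ∀ q, L.fiber q), IsOpen U → L.SmoothSectionOn U ψ →
    SmoothFormOn U (fun q =>
      { toFun := fun X => (A q X (ψ q) : H2)
        map_add' := fun X Y => by simp
        map_smul' := fun r X => by rw [map_smul]; rfl })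
  type_K : ∀ (p : M) (X : TSpace p) (v : L.fiber p), A p (rot p X) v = L.J p (A p X v)
  anti : ∀ (p : M) (X : TSpace p) (v : L.fiber p), A p X (L.J p v) = -L.J p (A p X v)

end ComplexQuaternionicLine

section MeanCurvatureSphere

variable {M : Type*} [TopologicalSpace M] [ChartedSpace ℂ M]

/-- A complex structure `S` on the quaternionic bundle `M × ℍ²`: a smooth map from `M` into the
quaternionic linear endomorphisms of `ℍ²`, with `S² = -1`. Quaternionic linear endomorphisms
are regarded as elements of the real vector space of all real linear endomorphisms. -/
structure IsComplexStructure (S : M → (H2 →L[ℝ] H2)) : Prop where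
  smooth : ContMDiff 𝓘(ℝ, ℂ) 𝓘(ℝ, H2 →L[ℝ] H2) ∞ S
  linear : ∀ (p : M) (c : ℍ[ℝ]ᵐᵒᵖ) (v : H2), S p (c • v) = c • S p v
  sq : ∀ (p : M) (v : H2), S p (S p v) = -v

/-- The Hopf field `A = ¼ (S dS + *dS)`. -/
noncomputable def hopfA (S : M → (H2 →L[ℝ] H2)) (p : M) : TSpace p →ₗ[ℝ] (H2 →L[ℝ] H2) where
  toFun X := (1 / 4 : ℝ) • ((S p).comp (diff S p X) + diff S p (rot p X))
  map_add' X Y := by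
    simp only [map_add, ContinuousLinearMap.comp_add, smul_add]; abel
  map_smul' r X := by
    simp only [map_smul, ContinuousLinearMap.comp_smul, smul_add, RingHom.id_apply,
      smul_comm r (1 / 4 : ℝ)]

/-- The Hopf field `Q = ¼ (S dS - *dS)`. -/
noncomputable def hopfQ (S : M → (H2 →L[ℝ] H2)) (p : M) (X : TSpace p) : H2 →L[ℝ] H2 :=
  (1 / 4 : ℝ) • ((S p).comp (diff S p X) - diff S p (rot p X))

/-- `S` is the mean curvature sphere congruence of the quaternionic line subbundle `L`: a complex
structure on `M × ℍ²` with `SL = L`, `dS L ⊂ L`, `*δ = δ ∘ S = S ∘ δ` and `Q|_L = 0`. -/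
structure IsMeanCurvatureSphere (L : LineSubbundle ℍ[ℝ]ᵐᵒᵖ M) (S : M → (H2 →L[ℝ] H2)) : Prop
    extends IsComplexStructure S where
  image_eq : ∀ p, S p '' (L.fiber p : Set H2) = L.fiber p
  dS_mem : ∀ (p : M) (X : TSpace p), ∀ v ∈ L.fiber p, diff S p X v ∈ L.fiber p
  star_delta_eq_delta_S : ∀ (p : M) (X : TSpace p) (v w : L.fiber p), (w : H2) = S p v →
    L.delta p (rot p X) v = L.delta p X w
  star_delta_eq_S_delta : ∀ (p : M) (X : TSpace p) (v : L.fiber p) (u : H2),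
    (L.fiber p).mkQ u = L.delta p X v → L.delta p (rot p X) v = (L.fiber p).mkQ (S p u)
  Q_eq_zero : ∀ (p : M) (X : TSpace p), ∀ v ∈ L.fiber p, hopfQ S p X v = 0

/-- `A ∈ Γ(K End₋(H))` for `H = M × ℍ²` with complex structure `S`: the form `A` is smooth with
values in the quaternionic linear endomorphisms, `*A = S A`, and `A S = - S A`. -/
structure IsKEndMinusH (S : M → (H2 →L[ℝ] H2)) (A : ∀ p : M, TSpace p →ₗ[ℝ] (H2 →L[ℝ] H2)) :
    Prop where
  smooth : SmoothFormOn (F := H2 →L[ℝ] H2) Set.univ A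
  linear : ∀ (p : M) (X : TSpace p) (c : ℍ[ℝ]ᵐᵒᵖ) (v : H2), A p X (c • v) = c • A p X v
  type_K : ∀ (p : M) (X : TSpace p), A p (rot p X) = (S p).comp (A p X)
  anti : ∀ (p : M) (X : TSpace p), (A p X).comp (S p) = -(S p).comp (A p X)

end MeanCurvatureSphere

/-! Everything is read off from `D̃ψ = ½(dψ + *d(Jψ))`. Modulo `L` it is `½(δ_L + *δ_L J)ψ`, so it
takes values in `L` exactly when `(L, J)` is holomorphic. On sections `φ` of `E` one has `Jφ = φi`,
so modulo `E` the same `D̃φ` is `½(δ_E + *δ_E J_E)φ`. Since `E` generates `L` over `ℍ`, this gives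
(i).

From `J² = -1` and `** = -1` follows `D̃J = -*D̃`. Hence `½(D̃ + JD̃J)` is the (1,0)-part of `D̃`
and has the symmetries of `K End₋(L)`. It is tensorial: where `ψ` vanishes, `d(Jψ) = J dψ` and all
terms cancel (`hopfOp_eq_zero_of_eq_zero`).

For (ii), `E` is the `i`-eigenspace of `J`, and `v ↦ v - (Jv)i` maps `L` into it. As `D̃φ - A_Lφ` is
half the image of `D̃φ` under this map, `D̃φ` and `A_Lφ` agree modulo `E` (`halfDelta_eq_mkQ`). If
they vanish there, `A_L` maps `E` to `E`, where `J` is multiplication by `i`, and `A_L J = -J A_L`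
forces `A_L = 0`. In the converse direction the eigenspaces of `J` recover `E` from `(L, J)`
(`twistorProjection_eigenbundle`).

Part (iii) is the product rule `d(Sψ) = (dS)ψ + S dψ`: in `A_Lψ` the terms with `dψ` cancel. -/

/-! ### Differentials and 1-forms on a Riemann surface -/

section Differential

variable {M : Type*} [TopologicalSpace M] [ChartedSpace ℂ M]
  {F G : Type*} [NormedAddCommGroup F] [NormedSpace ℝ F] [NormedAddCommGroup G] [NormedSpace ℝ G]

theorem diff_congr {f g : M → F} {p : M} (h : f =ᶠ[nhds p] g) (X : TSpace p) :
    diff f p X = diff g p X := by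
  have := h.mfderiv_eq (I := 𝓘(ℝ, ℂ)) (I' := 𝓘(ℝ, F))
  exact congrArg (fun T : TSpace p →L[ℝ] F => T X) this

theorem diff_eq_of_hasMFDerivAt {f : M → F} {p : M} {f' : TSpace p →L[ℝ] F}
    (h : HasMFDerivAt 𝓘(ℝ, ℂ) 𝓘(ℝ, F) f p f') (X : TSpace p) : diff f p X = f' X :=
  congrArg (fun T : TSpace p →L[ℝ] F => T X) h.mfderiv

theorem diff_clm_comp (T : F →L[ℝ] G) {f : M → F} {p : M}
    (hf : MDifferentiableAt 𝓘(ℝ, ℂ) 𝓘(ℝ, F) f p) (X : TSpace p) :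
    diff (fun q => T (f q)) p X = T (diff f p X) :=
  diff_eq_of_hasMFDerivAt (f' := T.comp (mfderiv 𝓘(ℝ, ℂ) 𝓘(ℝ, F) f p : TSpace p →L[ℝ] F))
    (HasMFDerivAt.comp (I' := 𝓘(ℝ, F)) p (T.hasFDerivAt (x := f p)).hasMFDerivAt
      hf.hasMFDerivAt) X

theorem diff_sub {f g : M → F} {p : M} (hf : MDifferentiableAt 𝓘(ℝ, ℂ) 𝓘(ℝ, F) f p)
    (hg : MDifferentiableAt 𝓘(ℝ, ℂ) 𝓘(ℝ, F) g p) (X : TSpace p) :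
    diff (fun q => f q - g q) p X = diff f p X - diff g p X :=
  diff_eq_of_hasMFDerivAt (hf.hasMFDerivAt.sub hg.hasMFDerivAt) X

theorem diff_neg {f : M → F} {p : M} (hf : MDifferentiableAt 𝓘(ℝ, ℂ) 𝓘(ℝ, F) f p)
    (X : TSpace p) : diff (fun q => - f q) p X = - diff f p X :=
  diff_eq_of_hasMFDerivAt hf.hasMFDerivAt.neg X

/-- The product rule for a continuous bilinear map. -/
theorem diff_bilinear {F' : Type*} [NormedAddCommGroup F'] [NormedSpace ℝ F']
    (B : F →L[ℝ] G →L[ℝ] F') {f : M → F} {g : M → G} {p : M}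
    (hf : MDifferentiableAt 𝓘(ℝ, ℂ) 𝓘(ℝ, F) f p) (hg : MDifferentiableAt 𝓘(ℝ, ℂ) 𝓘(ℝ, G) g p)
    (X : TSpace p) :
    diff (fun q => B (f q) (g q)) p X = B (diff f p X) (g p) + B (f p) (diff g p X) := by
  have hB := (B.isBoundedBilinearMap.hasFDerivAt (f p, g p)).hasMFDerivAt
  have hfg : HasMFDerivAt 𝓘(ℝ, ℂ) 𝓘(ℝ, F × G) (fun q => (f q, g q)) p
      ((mfderiv 𝓘(ℝ, ℂ) 𝓘(ℝ, F) f p : TSpace p →L[ℝ] F).prod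
        (mfderiv 𝓘(ℝ, ℂ) 𝓘(ℝ, G) g p : TSpace p →L[ℝ] G)) :=
    ⟨hf.hasMFDerivAt.1.prodMk hg.hasMFDerivAt.1, hf.hasMFDerivAt.2.prodMk hg.hasMFDerivAt.2⟩
  have h := diff_eq_of_hasMFDerivAt (HasMFDerivAt.comp (I' := 𝓘(ℝ, F × G)) p hB hfg) X
  refine h.trans ?_
  rw [add_comm]
  rfl

theorem contMDiffOn_real_smul (r : ℝ) {f : M → F} {U : Set M}
    (hf : ContMDiffOn 𝓘(ℝ, ℂ) 𝓘(ℝ, F) ∞ f U) :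
    ContMDiffOn 𝓘(ℝ, ℂ) 𝓘(ℝ, F) ∞ (fun q => r • f q) U :=
  (r • ContinuousLinearMap.id ℝ F).contDiff.contMDiff.comp_contMDiffOn hf

theorem rot_rot (p : M) (X : TSpace p) : rot p (rot p X) = -X := by
  have h : ∀ z : ℂ, Complex.I * (Complex.I * z) = -z := fun z => by
    rw [← mul_assoc, Complex.I_mul_I, neg_one_mul]
  exact h X

/-- A Riemann surface is a smooth real manifold. -/
theorem isManifold_real [IsManifold 𝓘(ℂ) ω M] : IsManifold 𝓘(ℝ, ℂ) ∞ M := by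
  refine isManifold_of_contDiffOn _ _ _ fun e e' he he' => ?_
  have h := ((contDiffGroupoid ω 𝓘(ℂ)).compatible he he').1
  simp only [contDiffPregroupoid] at h
  exact (h.restrict_scalars ℝ).of_le (by simp)

theorem HasMFDerivAt.restrictScalars_real {N : Type*} [TopologicalSpace N] [ChartedSpace ℂ N]
    {f : M → N} {p : M}
    {f' : TangentSpace 𝓘(ℂ) p →L[ℂ] TangentSpace 𝓘(ℂ) (f p)}
    (h : HasMFDerivAt 𝓘(ℂ) 𝓘(ℂ) f p f') :
    HasMFDerivAt 𝓘(ℝ, ℂ) 𝓘(ℝ, ℂ) f p ((f' : ℂ →L[ℂ] ℂ).restrictScalars ℝ) :=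
  have h2 : HasFDerivWithinAt (chartAt ℂ (f p) ∘ f ∘ (chartAt ℂ p).symm) (f' : ℂ →L[ℂ] ℂ)
      Set.univ (chartAt ℂ p p) := by
    simpa [mfld_simps, writtenInExtChartAt] using h.2
  ⟨h.1, by
    have h3 := h2.restrictScalars ℝ
    simp only [mfld_simps, writtenInExtChartAt]
    exact h3⟩

/-- Charts are holomorphic, so their differentials commute with `i`. Hence the `w`-component of `*η`
is the `iw`-component of `η`, and `*` preserves smoothness. -/
theorem rot_coordField [IsManifold 𝓘(ℂ) ω M] (p₀ : M) (w : ℂ) {q : M}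
    (hq : q ∈ (chartAt ℂ p₀).source) :
    rot q (coordField p₀ w q) = coordField p₀ (Complex.I * w) q := by
  have hd : MDifferentiableAt 𝓘(ℂ) 𝓘(ℂ) (chartAt ℂ p₀).symm (chartAt ℂ p₀ q) :=
    ((contMDiffOn_chart_symm (I := 𝓘(ℂ)) (n := ω) (x := p₀)).contMDiffAt
      ((chartAt ℂ p₀).open_target.mem_nhds ((chartAt ℂ p₀).map_source hq))).mdifferentiableAt
      (by simp)
  have h := hd.hasMFDerivAt.restrictScalars_real.mfderiv
  have h' : ∀ v : ℂ, (mfderiv 𝓘(ℝ, ℂ) 𝓘(ℝ, ℂ) (chartAt ℂ p₀).symm (chartAt ℂ p₀ q) : ℂ → ℂ) v =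
      (mfderiv 𝓘(ℂ) 𝓘(ℂ) (chartAt ℂ p₀).symm (chartAt ℂ p₀ q) : ℂ →L[ℂ] ℂ) v := fun v =>
    congrArg (fun T : ℂ →L[ℝ] ℂ => T v) h
  refine (congrArg (fun z : ℂ => Complex.I * z) (h' w)).trans ?_
  refine Eq.trans ?_ (h' (Complex.I * w)).symm
  exact ((mfderiv 𝓘(ℂ) 𝓘(ℂ) (chartAt ℂ p₀).symm (chartAt ℂ p₀ q) : ℂ →L[ℂ] ℂ).map_smul
    Complex.I w).symm

/-- By the chain rule the component is the directional derivative of `f ∘ e.symm` along `w`, pulled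
back by the chart `e`. -/
theorem contMDiffOn_diff_coordField [IsManifold 𝓘(ℝ, ℂ) ∞ M] {f : M → F} {U : Set M}
    (hU : IsOpen U) (hf : ContMDiffOn 𝓘(ℝ, ℂ) 𝓘(ℝ, F) ∞ f U) (p₀ : M) (w : ℂ) :
    ContMDiffOn 𝓘(ℝ, ℂ) 𝓘(ℝ, F) ∞ (fun q => diff f q (coordField p₀ w q))
      (U ∩ (chartAt ℂ p₀).source) := by
  set e := chartAt ℂ p₀ with he
  have hW : IsOpen (e.target ∩ e.symm ⁻¹' U) := e.symm.isOpen_inter_preimage hU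
  have hg : ContDiffOn ℝ ∞ (f ∘ e.symm) (e.target ∩ e.symm ⁻¹' U) := by
    rw [← contMDiffOn_iff_contDiffOn]
    exact hf.comp ((contMDiffOn_chart_symm (I := 𝓘(ℝ, ℂ)) (n := ∞) (x := p₀)).mono
      Set.inter_subset_left) Set.inter_subset_right
  have hg' : ContDiffOn ℝ ∞ (fun y => fderiv ℝ (f ∘ e.symm) y w) (e.target ∩ e.symm ⁻¹' U) :=
    (hg.fderiv_of_isOpen hW (by simp)).clm_apply contDiffOn_const
  have hc : ContMDiffOn 𝓘(ℝ, ℂ) 𝓘(ℝ, F) ∞ (fun q => fderiv ℝ (f ∘ e.symm) (e q) w)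
      (U ∩ e.source) :=
    hg'.contMDiffOn.comp ((contMDiffOn_chart (I := 𝓘(ℝ, ℂ)) (n := ∞) (x := p₀)).mono
      Set.inter_subset_right) fun q hq => ⟨e.map_source hq.2, by
        change e.symm (e q) ∈ U; rw [e.left_inv hq.2]; exact hq.1⟩
  refine hc.congr fun q hq => ?_
  have hd : MDifferentiableAt 𝓘(ℝ, ℂ) 𝓘(ℝ, ℂ) e.symm (e q) :=
    ((contMDiffOn_chart_symm (I := 𝓘(ℝ, ℂ)) (n := ∞) (x := p₀)).contMDiffAt
      (e.open_target.mem_nhds (e.map_source hq.2))).mdifferentiableAt (by simp)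
  have hfd : MDifferentiableAt 𝓘(ℝ, ℂ) 𝓘(ℝ, F) f q :=
    (hf.contMDiffAt (hU.mem_nhds hq.1)).mdifferentiableAt (by simp)
  have hh : HasMFDerivAt 𝓘(ℝ, ℂ) 𝓘(ℝ, F) f (e.symm (e q))
      (mfderiv 𝓘(ℝ, ℂ) 𝓘(ℝ, F) f (e.symm (e q))) := by
    rw [e.left_inv hq.2]; exact hfd.hasMFDerivAt
  have h : HasFDerivAt (f ∘ e.symm)
      ((mfderiv 𝓘(ℝ, ℂ) 𝓘(ℝ, F) f (e.symm (e q)) : ℂ →L[ℝ] F).comp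
        (mfderiv 𝓘(ℝ, ℂ) 𝓘(ℝ, ℂ) e.symm (e q) : ℂ →L[ℝ] ℂ)) (e q) :=
    hasMFDerivAt_iff_hasFDerivAt.1 (hh.comp (e q) hd.hasMFDerivAt)
  have hw : ∀ T : ℂ →L[ℝ] F, HasFDerivAt (f ∘ e.symm) T (e q) →
      T w = fderiv ℝ (f ∘ e.symm) (e q) w := fun T hT => by rw [hT.fderiv]
  -- The points `e.symm (e q)` and `q` are only propositionally equal; a variable `q'` makes the
  -- substitution possible in the type of the derivative.
  have h2 : ∀ q' : M, q' = q → ∀ v : ℂ, (mfderiv 𝓘(ℝ, ℂ) 𝓘(ℝ, F) f q : ℂ → F) v =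
      (mfderiv 𝓘(ℝ, ℂ) 𝓘(ℝ, F) f q' : ℂ → F) v := by
    rintro _ rfl v; rfl
  exact (h2 _ (e.left_inv hq.2) _).trans (hw _ h)

end Differential

/-- Multiplication by a scalar, as a real linear endomorphism of `ℍ²`. -/
noncomputable def smulCLM {R : Type} [Ring R] [Module R H2] [SMulCommClass R ℝ H2] (c : R) :
    H2 →L[ℝ] H2 :=
  LinearMap.toContinuousLinearMap
    { toFun := fun v => c • v
      map_add' := smul_add c
      map_smul' := fun r v => smul_comm c r v }

theorem smulCLM_apply {R : Type} [Ring R] [Module R H2] [SMulCommClass R ℝ H2] (c : R) (v : H2) :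
    smulCLM c v = c • v := rfl

/-- The right multiplication `(b, v) ↦ v b`, as a real bilinear map. -/
noncomputable def rightMul : ℍ[ℝ] →L[ℝ] H2 →L[ℝ] H2 :=
  LinearMap.toContinuousLinearMap
    { toFun := fun b => smulCLM (MulOpposite.op b)
      map_add' := fun b c => by ext1 v; simp [smulCLM_apply, add_smul]
      map_smul' := fun r b => by ext1 v; simp [smulCLM_apply] }

theorem rightMul_apply (b : ℍ[ℝ]) (v : H2) : rightMul b v = MulOpposite.op b • v := rfl

/-! ### Local sections of line subbundles -/

section

variable {M : Type*} [TopologicalSpace M] [ChartedSpace ℂ M]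

theorem diff_smul {R : Type} [Ring R] [Module R H2] [SMulCommClass R ℝ H2] (c : R) {f : M → H2}
    {p : M} (hf : MDifferentiableAt 𝓘(ℝ, ℂ) 𝓘(ℝ, H2) f p) (X : TSpace p) :
    diff (fun q => c • f q) p X = c • diff f p X :=
  diff_clm_comp (smulCLM c) hf X

namespace LineSubbundle

theorem SmoothSectionOn.smul {R : Type} [Ring R] [Module R H2] [SMulCommClass R ℝ H2]
    {E : LineSubbundle R M} {U : Set M} {φ : ∀ q, E.fiber q} (hφ : E.SmoothSectionOn U φ) (c : R) :
    E.SmoothSectionOn U (fun q => c • φ q) :=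
  (smulCLM c).contDiff.contMDiff.comp_contMDiffOn (n := ∞) hφ

theorem SmoothSectionOn.sub {R : Type} [Ring R] [Module R H2] {E : LineSubbundle R M}
    {U V : Set M} {φ ψ : ∀ q, E.fiber q} (hφ : E.SmoothSectionOn U φ)
    (hψ : E.SmoothSectionOn V ψ) : E.SmoothSectionOn (U ∩ V) (fun q => φ q - ψ q) :=
  ContMDiffOn.sub (ContMDiffOn.mono hφ Set.inter_subset_left)
    (ContMDiffOn.mono hψ Set.inter_subset_right)

/-- Every vector of a fibre is the value of a local section. -/
theorem exists_section {R : Type} [Ring R] [Module R H2] [SMulCommClass R ℝ H2]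
    (E : LineSubbundle R M) (p : M) (v : E.fiber p) :
    ∃ (U : Set M) (φ : ∀ q, E.fiber q), IsOpen U ∧ p ∈ U ∧ E.SmoothSectionOn U φ ∧ φ p = v := by
  obtain ⟨V, hV, hpV, σ, hσ, hspan⟩ := E.exists_frame p
  obtain ⟨c, hc⟩ := Submodule.mem_span_singleton.1 ((hspan p hpV).2.le v.2)
  exact ⟨V, fun q => c • σ q, hV, hpV, SmoothSectionOn.smul hσ c, Subtype.ext hc⟩

/-- Near `p`, a section of a quaternionic line bundle is a smooth multiple of a frame. -/
theorem exists_coefficient (L : LineSubbundle ℍ[ℝ]ᵐᵒᵖ M) {U V : Set M} (hU : IsOpen U)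
    (hV : IsOpen V) {ψ σ : ∀ q, L.fiber q} (hψ : L.SmoothSectionOn U ψ)
    (hσ : L.SmoothSectionOn V σ) {p : M} (hpU : p ∈ U) (hpV : p ∈ V)
    (hspan : ∀ q ∈ V, (σ q : H2) ≠ 0 ∧ L.fiber q = Submodule.span ℍ[ℝ]ᵐᵒᵖ {(σ q : H2)}) :
    ∃ b : M → ℍ[ℝ], MDifferentiableAt 𝓘(ℝ, ℂ) 𝓘(ℝ, ℍ[ℝ]) b p ∧
      (∀ᶠ q in nhds p, ψ q = MulOpposite.op (b q) • σ q) := by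
  obtain ⟨k, hk⟩ := exists_coord_ne_zero (hspan p hpV).1
  have hσk := mdifferentiableAt_coord (mdifferentiableAt_of_section hV hσ hpV) k
  have hψk := mdifferentiableAt_coord (mdifferentiableAt_of_section hU hψ hpU) k
  -- With `σ_k` nonzero near `p`, the equation `ψ = σb` forces `b = σ_k⁻¹ ψ_k`.
  refine ⟨(fun q => ((σ q : H2) k))⁻¹ * (fun q => (ψ q : H2) k),
    ((hσk.mdifferentiableAt.inv hk).hasMFDerivAt.mul' hψk).mdifferentiableAt, ?_⟩
  filter_upwards [hσk.mdifferentiableAt.continuousAt.eventually_ne hk, hV.mem_nhds hpV]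
    with q hq hqV
  obtain ⟨c, hc⟩ := Submodule.mem_span_singleton.1 ((hspan q hqV).2.le (ψ q).2)
  have hck : (ψ q : H2) k = (σ q : H2) k * c.unop := by rw [← hc]; rfl
  have hcq : ψ q = c • σ q := Subtype.ext hc.symm
  rw [Pi.mul_apply, Pi.inv_apply, hck, ← mul_assoc, inv_mul_cancel₀ hq, one_mul, hcq]
  rfl

end LineSubbundle

/-! ### The operator `D̃` and the Hopf field `A_L` -/

namespace ComplexQuaternionicLine

variable (L : ComplexQuaternionicLine M)

/-- The differential of `J ψ` at a zero of the section `ψ`. -/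
theorem diff_J_of_eq_zero {U : Set M} (hU : IsOpen U) {ψ : ∀ q, L.fiber q}
    (hψ : L.SmoothSectionOn U ψ) {p : M} (hp : p ∈ U) (h0 : ψ p = 0) (X : TSpace p)
    (h : diff (fun q => (ψ q : H2)) p X ∈ L.fiber p) :
    diff (fun q => (L.J q (ψ q) : H2)) p X = L.J p ⟨diff (fun q => (ψ q : H2)) p X, h⟩ := by
  obtain ⟨V, hV, hpV, σ, hσ, hspan⟩ := L.exists_frame p
  obtain ⟨b, hb, hbψ⟩ := L.exists_coefficient hU hV hψ hσ hp hpV hspan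
  have hσd := LineSubbundle.mdifferentiableAt_of_section (E := L.toLineSubbundle) hV hσ hpV
  have hJσd := LineSubbundle.mdifferentiableAt_of_section (E := L.toLineSubbundle) hV
    (L.J_smooth V σ hV hσ) hpV
  have hb0 : b p = 0 := by
    have h1 := hbψ.self_of_nhds
    rw [h0] at h1
    have h2 : MulOpposite.op (b p) • (σ p : H2) = 0 := (congrArg Subtype.val h1).symm
    rcases smul_eq_zero.1 h2 with h3 | h3
    · simpa using h3
    · exact absurd h3 (hspan p hpV).1
  -- Near `p`, `ψ = σb` and `Jψ = (Jσ)b` with the same `b`. As `b p = 0`, the product rule leaves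
  -- only the terms with `db`, so derivatives of `J` do not enter.
  have e1 : diff (fun q => (ψ q : H2)) p X = MulOpposite.op (diff b p X) • (σ p : H2) := by
    rw [diff_congr (g := fun q => rightMul (b q) (σ q : H2))
      (hbψ.mono fun q hq => congrArg Subtype.val hq), diff_bilinear rightMul hb hσd, hb0]
    simp [rightMul_apply]
  have e2 : diff (fun q => (L.J q (ψ q) : H2)) p X =
      MulOpposite.op (diff b p X) • (L.J p (σ p) : H2) := by
    rw [diff_congr (g := fun q => rightMul (b q) (L.J q (σ q) : H2))
      (hbψ.mono fun q hq => by simp only [hq, map_smul]; rfl),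
      diff_bilinear rightMul hb hJσd, hb0]
    simp [rightMul_apply]
  have e3 : (⟨diff (fun q => (ψ q : H2)) p X, h⟩ : L.fiber p) =
      MulOpposite.op (diff b p X) • σ p := Subtype.ext e1
  rw [e2, e3, map_smul]
  rfl

/-- An extension lets `J` act on vectors whose membership in `L` is proved separately. It is chosen
pointwise, without continuity in `p`, and matters only on `L`. -/
theorem exists_JExt (p : M) : ∃ T : H2 →ₗ[ℍ[ℝ]ᵐᵒᵖ] H2, ∀ v : L.fiber p, T v = L.J p v := by
  obtain ⟨T, hT⟩ := LinearMap.exists_extend ((L.fiber p).subtype.comp (L.J p))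
  exact ⟨T, fun v => LinearMap.congr_fun hT v⟩

/-- Some quaternionic linear extension of `J` to `ℍ²`. -/
noncomputable def JExt (p : M) : H2 →ₗ[ℍ[ℝ]ᵐᵒᵖ] H2 := (L.exists_JExt p).choose

theorem JExt_apply {p : M} (v : L.fiber p) : L.JExt p v = L.J p v :=
  (L.exists_JExt p).choose_spec v

theorem JExt_mem {p : M} {v : H2} (hv : v ∈ L.fiber p) : L.JExt p v ∈ L.fiber p := by
  rw [L.JExt_apply ⟨v, hv⟩]; exact (L.J p _).2

theorem JExt_JExt {p : M} {v : H2} (hv : v ∈ L.fiber p) : L.JExt p (L.JExt p v) = -v := by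
  rw [L.JExt_apply ⟨v, hv⟩, L.JExt_apply, L.J_sq]; rfl

theorem JExt_real_smul {p : M} (r : ℝ) (v : H2) : L.JExt p (r • v) = r • L.JExt p v := by
  have h : ∀ w : H2, r • w = MulOpposite.op (r : ℍ[ℝ]) • w := fun w => by
    funext k
    change r • w k = w k * (r : ℍ[ℝ])
    rw [Quaternion.mul_coe_eq_smul]
  rw [h, h, map_smul]

variable {L}

theorem dTilde_apply (ψ : ∀ q, L.fiber q) (p : M) (X : TSpace p) :
    L.dTilde ψ p X = (1 / 2 : ℝ) • (diff (fun q => (ψ q : H2)) p X +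
      diff (fun q => (L.J q (ψ q) : H2)) p (rot p X)) := rfl

section Operator

variable {U : Set M} {ψ : ∀ q, L.fiber q} {p : M}

theorem diff_J_J (hU : IsOpen U) (hψ : L.SmoothSectionOn U ψ) (hp : p ∈ U) (X : TSpace p) :
    diff (fun q => (L.J q (L.J q (ψ q)) : H2)) p X = -diff (fun q => (ψ q : H2)) p X := by
  rw [← diff_neg (LineSubbundle.mdifferentiableAt_of_section hU hψ hp)]
  simp only [L.J_sq]
  rfl

/-- This is `D̃J = -*D̃`: `J² = -1` and `** = -1` interchange the two terms of `D̃`. Both the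
(1,0)-part formula and the type of `A_L` rest on it. -/
theorem dTilde_J (hU : IsOpen U) (hψ : L.SmoothSectionOn U ψ) (hp : p ∈ U) (X : TSpace p) :
    L.dTilde (fun q => L.J q (ψ q)) p X = -L.dTilde ψ p (rot p X) := by
  rw [dTilde_apply, dTilde_apply, diff_J_J hU hψ hp, rot_rot, map_neg, ← smul_neg, neg_add,
    neg_neg, add_comm]

/-- Modulo `L`, twice `D̃ψ` is `δψ + *δ(Jψ)`. Holomorphy applied to `Jψ` turns the second term into
`δ(J²ψ) = -δψ`. -/
theorem dTilde_mem (hL : L.IsHolomorphicCurve) (hU : IsOpen U) (hψ : L.SmoothSectionOn U ψ)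
    (hp : p ∈ U) (X : TSpace p) : L.dTilde ψ p X ∈ L.fiber p := by
  rw [← Submodule.Quotient.mk_eq_zero]
  have h1 := L.delta_apply hU hψ hp X
  have h2 := L.delta_apply hU (L.J_smooth U ψ hU hψ) hp (rot p X)
  have h3 := hL p X (L.J p (ψ p))
  rw [L.J_sq, map_neg] at h3
  have h4 : (L.fiber p).mkQ (diff (fun q => (ψ q : H2)) p X +
      diff (fun q => (L.J q (ψ q) : H2)) p (rot p X)) = 0 := by
    rw [map_add, ← h1, ← h2, h3, add_neg_cancel]
  have h5 := (Submodule.Quotient.mk_eq_zero _).1 h4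
  rw [Submodule.Quotient.mk_eq_zero, dTilde_apply]
  exact ((L.fiber p).restrictScalars ℝ).smul_mem _ h5

theorem dTilde_sub {V : Set M} {φ : ∀ q, L.fiber q} (hU : IsOpen U)
    (hψ : L.SmoothSectionOn U ψ) (hp : p ∈ U) (hV : IsOpen V) (hφ : L.SmoothSectionOn V φ)
    (hpV : p ∈ V) (X : TSpace p) :
    L.dTilde (fun q => ψ q - φ q) p X = L.dTilde ψ p X - L.dTilde φ p X := by
  have h1 := diff_sub (LineSubbundle.mdifferentiableAt_of_section hU hψ hp)
    (LineSubbundle.mdifferentiableAt_of_section hV hφ hpV) X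
  have h2 := diff_sub
    (LineSubbundle.mdifferentiableAt_of_section hU (L.J_smooth U ψ hU hψ) hp)
    (LineSubbundle.mdifferentiableAt_of_section hV (L.J_smooth V φ hV hφ) hpV) (rot p X)
  simp only [dTilde_apply, map_sub]
  rw [← smul_sub]
  congr 1
  refine (congrArg₂ (· + ·) h1 h2).trans ?_
  abel

theorem dTilde_smul (hU : IsOpen U) (hψ : L.SmoothSectionOn U ψ) (hp : p ∈ U)
    (c : ℍ[ℝ]ᵐᵒᵖ) (X : TSpace p) :
    L.dTilde (fun q => c • ψ q) p X = c • L.dTilde ψ p X := by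
  have h1 := diff_smul c (LineSubbundle.mdifferentiableAt_of_section hU hψ hp) X
  have h2 := diff_smul c
    (LineSubbundle.mdifferentiableAt_of_section hU (L.J_smooth U ψ hU hψ) hp) (rot p X)
  simp only [dTilde_apply, map_smul]
  rw [smul_comm c (1 / 2 : ℝ), smul_add c]
  congr 1
  exact congrArg₂ (· + ·) h1 h2

/-- The operator `½ (D̃ + J D̃ J)` on sections of `L`. -/
noncomputable def hopfOp (L : ComplexQuaternionicLine M) (ψ : ∀ q, L.fiber q) (p : M)
    (X : TSpace p) : H2 :=
  (1 / 2 : ℝ) • (L.dTilde ψ p X + L.JExt p (L.dTilde (fun q => L.J q (ψ q)) p X))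

theorem hopfOp_mem (hL : L.IsHolomorphicCurve) (hU : IsOpen U) (hψ : L.SmoothSectionOn U ψ)
    (hp : p ∈ U) (X : TSpace p) : L.hopfOp ψ p X ∈ L.fiber p :=
  ((L.fiber p).restrictScalars ℝ).smul_mem _ (add_mem (dTilde_mem hL hU hψ hp X)
    (L.JExt_mem (dTilde_mem hL hU (L.J_smooth U ψ hU hψ) hp X)))

theorem hopfOp_smul (hU : IsOpen U) (hψ : L.SmoothSectionOn U ψ) (hp : p ∈ U)
    (c : ℍ[ℝ]ᵐᵒᵖ) (X : TSpace p) :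
    L.hopfOp (fun q => c • ψ q) p X = c • L.hopfOp ψ p X := by
  simp only [hopfOp, map_smul]
  rw [dTilde_smul hU hψ hp, dTilde_smul hU (L.J_smooth U ψ hU hψ) hp, map_smul,
    smul_comm c (1 / 2 : ℝ), smul_add c]

theorem hopfOp_sub {V : Set M} {φ : ∀ q, L.fiber q} (hU : IsOpen U)
    (hψ : L.SmoothSectionOn U ψ) (hp : p ∈ U) (hV : IsOpen V) (hφ : L.SmoothSectionOn V φ)
    (hpV : p ∈ V) (X : TSpace p) :
    L.hopfOp (fun q => ψ q - φ q) p X = L.hopfOp ψ p X - L.hopfOp φ p X := by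
  simp only [hopfOp, map_sub]
  rw [dTilde_sub hU hψ hp hV hφ hpV, dTilde_sub hU (L.J_smooth U ψ hU hψ) hp hV
    (L.J_smooth V φ hV hφ) hpV, map_sub, ← smul_sub]
  congr 1
  abel

/-- Tensoriality. At the zero `p`, `d(Jψ) = J dψ`, so `D̃ψ = ½(dψ + J*dψ)`, while `JD̃Jψ = -J*D̃ψ =
-½(J*dψ + dψ)`. -/
theorem hopfOp_eq_zero_of_eq_zero (hU : IsOpen U) (hψ : L.SmoothSectionOn U ψ) (hp : p ∈ U)
    (h0 : ψ p = 0) (X : TSpace p) : L.hopfOp ψ p X = 0 := by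
  have hm := fun Y => L.diff_mem_of_eq_zero hU hψ hp (congrArg Subtype.val h0) Y
  have hJ : ∀ Y, diff (fun q => (L.J q (ψ q) : H2)) p Y =
      L.JExt p (diff (fun q => (ψ q : H2)) p Y) := fun Y => by
    rw [L.diff_J_of_eq_zero hU hψ hp h0 Y (hm Y), ← L.JExt_apply]
  rw [hopfOp, dTilde_J hU hψ hp, dTilde_apply, dTilde_apply, hJ, hJ, rot_rot, map_neg, map_neg,
    map_neg, JExt_real_smul, map_add, map_neg, L.JExt_JExt (hm X), neg_neg, ← smul_neg,
    ← smul_add]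
  rw [add_comm (L.JExt p _), add_neg_cancel, smul_zero, smul_zero]

theorem hopfOp_congr {V : Set M} {φ : ∀ q, L.fiber q} (hU : IsOpen U)
    (hψ : L.SmoothSectionOn U ψ) (hp : p ∈ U) (hV : IsOpen V) (hφ : L.SmoothSectionOn V φ)
    (hpV : p ∈ V) (h : ψ p = φ p) (X : TSpace p) : L.hopfOp ψ p X = L.hopfOp φ p X := by
  rw [← sub_eq_zero, ← hopfOp_sub hU hψ hp hV hφ hpV]
  exact hopfOp_eq_zero_of_eq_zero (hU.inter hV)
    (LineSubbundle.SmoothSectionOn.sub hψ hφ) ⟨hp, hpV⟩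
    (by rw [h, sub_self]) X

/-- `½ (D̃ + J D̃ J)` is the `(1,0)`-part of `D̃`. -/
theorem hopfOp_eq_sub (hU : IsOpen U) (hψ : L.SmoothSectionOn U ψ) (hp : p ∈ U) (X : TSpace p) :
    L.hopfOp ψ p X =
      (1 / 2 : ℝ) • (L.dTilde ψ p X - L.JExt p (L.dTilde ψ p (rot p X))) := by
  rw [hopfOp, dTilde_J hU hψ hp, map_neg, sub_eq_add_neg]

end Operator

theorem isAL_iff (hL : L.IsHolomorphicCurve) (A : L.EndForm) :
    L.IsAL A ↔ ∀ (U : Set M) (ψ : ∀ q, L.fiber q), IsOpen U → L.SmoothSectionOn U ψ →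
      ∀ p ∈ U, ∀ X : TSpace p, (A p X (ψ p) : H2) = L.hopfOp ψ p X := by
  refine forall₅_congr fun U ψ hU hψ p => forall₂_congr fun hp X => ?_
  have h := dTilde_mem hL hU (L.J_smooth U ψ hU hψ) hp X
  rw [hopfOp, L.JExt_apply ⟨_, h⟩]
  exact ⟨fun ⟨_, h'⟩ => h', fun h' => ⟨h, h'⟩⟩

/-- The value on a vector is computed from any local section through it; `hopfOp_congr` makes the
choice irrelevant and thereby yields additivity and linearity. -/
theorem exists_isAL (hL : L.IsHolomorphicCurve) : ∃ A : L.EndForm, L.IsAL A := by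
  choose U φ hU hp hφ hv using L.exists_section
  have hadd : ∀ p (v w : L.fiber p) X, L.hopfOp (φ p (v + w)) p X =
      L.hopfOp (φ p v) p X + L.hopfOp (φ p w) p X := fun p v w X => by
    rw [← sub_eq_iff_eq_add, ← hopfOp_sub (hU p _) (hφ p _) (hp p _) (hU p _) (hφ p _) (hp p _)]
    exact hopfOp_congr ((hU p _).inter (hU p _))
      (LineSubbundle.SmoothSectionOn.sub (hφ p _) (hφ p _))
      ⟨hp p _, hp p _⟩ (hU p _) (hφ p _) (hp p _) (by simp [hv]) X
  refine ⟨fun p =>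
    { toFun := fun X =>
        { toFun := fun v => ⟨L.hopfOp (φ p v) p X, hopfOp_mem hL (hU p v) (hφ p v) (hp p v) X⟩
          map_add' := fun v w => Subtype.ext (hadd p v w X)
          map_smul' := fun c v => Subtype.ext ?_ }
      map_add' := fun X Y => ?_
      map_smul' := fun r X => ?_ }, (isAL_iff hL _).2 fun V ψ hV hψ p hpV X => ?_⟩
  · exact (hopfOp_congr (hU p _) (hφ p _) (hp p _) (hU p v)
      (LineSubbundle.SmoothSectionOn.smul (hφ p v) c) (hp p v) (by simp [hv]) X).trans
      (hopfOp_smul (hU p v) (hφ p v) (hp p v) c X)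
  · ext1 v
    apply Subtype.ext
    change L.hopfOp (φ p v) p (X + Y) = L.hopfOp (φ p v) p X + L.hopfOp (φ p v) p Y
    simp only [hopfOp, map_add, ← smul_add]
    congr 1
    abel
  · ext1 v
    apply Subtype.ext
    change L.hopfOp (φ p v) p (r • X) = r • L.hopfOp (φ p v) p X
    simp only [hopfOp, map_smul, JExt_real_smul]
    rw [smul_comm r (1 / 2 : ℝ), smul_add r]
  · exact hopfOp_congr (hU p _) (hφ p _) (hp p _) hV hψ hpV (hv p _) X

theorem isAL_unique (hL : L.IsHolomorphicCurve) {A B : L.EndForm} (hA : L.IsAL A)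
    (hB : L.IsAL B) : A = B := by
  rw [isAL_iff hL] at hA hB
  funext p
  ext1 X
  ext1 v
  obtain ⟨U, φ, hU, hp, hφ, rfl⟩ := L.exists_section p v
  exact Subtype.ext ((hA U φ hU hφ p hp X).trans (hB U φ hU hφ p hp X).symm)

theorem IsAL.isOneZeroPart (hL : L.IsHolomorphicCurve) {A : L.EndForm} (hA : L.IsAL A) :
    L.IsOneZeroPart A := by
  intro U ψ hU hψ p hp X
  have h := dTilde_mem hL hU hψ hp (rot p X)
  refine ⟨h, ?_⟩
  rw [(isAL_iff hL A).1 hA U ψ hU hψ p hp X, hopfOp_eq_sub hU hψ hp, L.JExt_apply ⟨_, h⟩]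

theorem smoothFormOn_dTilde [IsManifold 𝓘(ℂ) ω M] {U : Set M} (hU : IsOpen U)
    {ψ : ∀ q, L.fiber q} (hψ : L.SmoothSectionOn U ψ) : SmoothFormOn U (L.dTilde ψ) := by
  have : IsManifold 𝓘(ℝ, ℂ) ∞ M := isManifold_real
  intro p₀ w
  have h1 := contMDiffOn_diff_coordField hU hψ p₀ w
  have h2 := contMDiffOn_diff_coordField hU (L.J_smooth U ψ hU hψ) p₀ (Complex.I * w)
  refine (contMDiffOn_real_smul (1 / 2) (h1.add h2)).congr fun q hq => ?_
  rw [dTilde_apply, rot_coordField p₀ w hq.2]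
  rfl

open Classical in
/-- `J` maps smooth maps into `L` to smooth maps. -/
theorem contMDiffOn_JExt {U : Set M} (hU : IsOpen U) {f : M → H2}
    (hf : ContMDiffOn 𝓘(ℝ, ℂ) 𝓘(ℝ, H2) ∞ f U) (hm : ∀ q ∈ U, f q ∈ L.fiber q) :
    ContMDiffOn 𝓘(ℝ, ℂ) 𝓘(ℝ, H2) ∞ (fun q => L.JExt q (f q)) U := by
  -- A section must be given on all of `M`; the default value `0` is never used over `U`.
  let φ : ∀ q, L.fiber q := fun q => if h : f q ∈ L.fiber q then ⟨f q, h⟩ else 0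
  have hφ : ∀ q ∈ U, (φ q : H2) = f q := fun q hq => by simp only [φ, dif_pos (hm q hq)]
  refine (L.J_smooth U φ hU (hf.congr hφ)).congr fun q hq => ?_
  rw [← hφ q hq, L.JExt_apply]

/-- Writing `A = ½(D̃ - J*D̃)` gives `*A = ½(*D̃ + JD̃) = JA`. Writing `A = ½(D̃ + JD̃J)` and using
`D̃J² = -D̃` gives `AJ = ½(D̃J - JD̃) = -JA`. -/
theorem IsAL.isKEndMinus [IsManifold 𝓘(ℂ) ω M] (hL : L.IsHolomorphicCurve) {A : L.EndForm}
    (hA : L.IsAL A) : L.IsKEndMinus A := by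
  rw [isAL_iff hL] at hA
  refine ⟨fun U ψ hU hψ p₀ w => ?_, fun p X v => ?_, fun p X v => ?_⟩
  · have hJ := L.J_smooth U ψ hU hψ
    have h1 := smoothFormOn_dTilde hU hψ p₀ w
    have h2 := smoothFormOn_dTilde hU hJ p₀ w
    have h3 := contMDiffOn_JExt (hU.inter (chartAt ℂ p₀).open_source) h2
      fun q hq => dTilde_mem hL hU hJ hq.1 _
    refine (contMDiffOn_real_smul (1 / 2) (h1.add h3)).congr fun q hq => ?_
    exact hA U ψ hU hψ q hq.1 _
  · obtain ⟨U, ψ, hU, hp, hψ, rfl⟩ := L.exists_section p v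
    apply Subtype.ext
    rw [← L.JExt_apply, hA U ψ hU hψ p hp, hA U ψ hU hψ p hp, hopfOp_eq_sub hU hψ hp,
      hopfOp_eq_sub hU hψ hp, JExt_real_smul, rot_rot, map_sub,
      L.JExt_JExt (dTilde_mem hL hU hψ hp _), map_neg, map_neg]
    congr 1
    abel
  · obtain ⟨U, ψ, hU, hp, hψ, rfl⟩ := L.exists_section p v
    apply Subtype.ext
    have hJ := L.J_smooth U ψ hU hψ
    have h1 := hA U _ hU hJ p hp X
    have h2 := hA U ψ hU hψ p hp X
    have h3 : L.dTilde (fun q => L.J q (L.J q (ψ q))) p X = -L.dTilde ψ p X := by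
      rw [dTilde_J hU hJ hp, dTilde_J hU hψ hp, rot_rot, map_neg, neg_neg]
    rw [h1, Submodule.coe_neg, ← L.JExt_apply, h2, hopfOp, hopfOp, h3, JExt_real_smul, map_add,
      L.JExt_JExt (dTilde_mem hL hU hJ hp X), map_neg, ← smul_neg]
    congr 1
    abel

end ComplexQuaternionicLine

end

/-! ### The `i`-eigenbundle of `J` -/

section

variable {M : Type*} [TopologicalSpace M] [ChartedSpace ℂ M]

namespace RightComplex

theorem I_smul_I_smul (v : H2) : I • (I • v) = -v := by
  rw [smul_smul, I_mul_I, neg_one_smul]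

theorem imJ_toQuaternion (z : ℂ) : (toQuaternion z).imJ = 0 := rfl

theorem imK_toQuaternion (z : ℂ) : (toQuaternion z).imK = 0 := rfl

theorem re_toQuaternion_I : (toQuaternion I).re = 0 := rfl

theorem imI_toQuaternion_I : (toQuaternion I).imI = 1 := rfl

theorem imJ_toQuaternion_I : (toQuaternion I).imJ = 0 := rfl

theorem imK_toQuaternion_I : (toQuaternion I).imK = 0 := rfl

/-- The quaternions that commute with `i` are the complex numbers. -/
theorem exists_toQuaternion_eq {b : ℍ[ℝ]} (h : toQuaternion I * b = b * toQuaternion I) :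
    ∃ z : RightComplex, toQuaternion z = b := by
  -- Left and right multiplication by `i` have opposite signs on the `j`, `k` plane, so these two
  -- components of `b` vanish.
  have h1 := congrArg QuaternionAlgebra.imJ h
  have h2 := congrArg QuaternionAlgebra.imK h
  simp only [Quaternion.imJ_mul, Quaternion.imK_mul, re_toQuaternion_I, imI_toQuaternion_I,
    imJ_toQuaternion_I, imK_toQuaternion_I] at h1 h2
  refine ⟨(⟨b.re, b.imI⟩ : ℂ), Quaternion.ext _ _ rfl rfl ?_ ?_⟩
  · rw [imJ_toQuaternion]; linarith
  · rw [imK_toQuaternion]; linarith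

/-- Cancelling a nonzero coordinate of `e` on the left leaves `i c = c i`, so `c` is complex. -/
theorem smul_mem_span {e : H2} (he : e ≠ 0) {c : ℍ[ℝ]ᵐᵒᵖ} (h : c • (I • e) = I • (c • e)) :
    c • e ∈ Submodule.span RightComplex {e} := by
  obtain ⟨k, hk⟩ := LineSubbundle.exists_coord_ne_zero he
  have h1 : e k * toQuaternion I * c.unop = e k * c.unop * toQuaternion I := congrFun h k
  rw [mul_assoc, mul_assoc] at h1
  obtain ⟨z, hz⟩ := exists_toQuaternion_eq (mul_left_cancel₀ hk h1)
  refine Submodule.mem_span_singleton.2 ⟨z, ?_⟩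
  rw [smul_eq_op_smul, hz, MulOpposite.op_unop]

end RightComplex

namespace ComplexQuaternionicLine

/-- The type of `J` depends on the fibres, so the two structures are compared on vectors of `ℍ²`. -/
theorem ext_of_fiber {L L' : ComplexQuaternionicLine M} (h : ∀ p, L.fiber p = L'.fiber p)
    (hJ : ∀ p v (hv : v ∈ L.fiber p) (hv' : v ∈ L'.fiber p),
      (L.J p ⟨v, hv⟩ : H2) = L'.J p ⟨v, hv'⟩) : L = L' := by
  obtain ⟨⟨fib, hfr⟩, J, _, _⟩ := L
  obtain ⟨⟨fib', hfr'⟩, J', _, _⟩ := L'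
  obtain rfl : fib = fib' := funext h
  obtain rfl : J = J' := by
    funext p
    ext1 v
    exact Subtype.ext (hJ p v v.2 v.2)
  rfl

variable (L : ComplexQuaternionicLine M)

theorem JExt_complex_smul {p : M} (z : RightComplex) (v : H2) :
    L.JExt p (z • v) = z • L.JExt p v := by
  rw [RightComplex.smul_eq_op_smul, map_smul]; rfl

theorem complex_smul_mem {p : M} (z : RightComplex) {v : H2} (hv : v ∈ L.fiber p) :
    z • v ∈ L.fiber p :=
  (L.fiber p).smul_mem (MulOpposite.op (RightComplex.toQuaternion z)) hv

/-- The subspace of `L` on which `J` is the right multiplication by `i`. -/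
noncomputable def eigenFiber (p : M) : Submodule RightComplex H2 where
  carrier := {v | v ∈ L.fiber p ∧ L.JExt p v = RightComplex.I • v}
  add_mem' := fun ha hb => ⟨add_mem ha.1 hb.1, by rw [map_add, ha.2, hb.2, smul_add]⟩
  zero_mem' := ⟨zero_mem _, by simp⟩
  smul_mem' := fun z v hv => ⟨L.complex_smul_mem z hv.1, by
    rw [L.JExt_complex_smul, hv.2, smul_comm]⟩

theorem fiber_eq_span {p : M} {e : H2} (he : e ∈ L.fiber p) (h0 : e ≠ 0) :
    L.fiber p = Submodule.span ℍ[ℝ]ᵐᵒᵖ {e} := by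
  obtain ⟨U, _, hp, σ, _, hspan⟩ := L.exists_frame p
  refine le_antisymm ?_ ((Submodule.span_singleton_le_iff_mem _ _).2 he)
  rw [(hspan p hp).2] at he ⊢
  obtain ⟨c, rfl⟩ := Submodule.mem_span_singleton.1 he
  rw [Submodule.span_singleton_le_iff_mem, Submodule.mem_span_singleton]
  have hc : c ≠ 0 := by rintro rfl; simp at h0
  exact ⟨c⁻¹, by rw [smul_smul, inv_mul_cancel₀ hc, one_smul]⟩

/-- If `e` and `ec` are both eigenvectors, then `e i c = J(ec) = e c i`, so `c` commutes with `i`.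
-/
theorem eigenFiber_eq_span {p : M} {e : H2} (he : e ∈ L.eigenFiber p) (h0 : e ≠ 0) :
    L.eigenFiber p = Submodule.span RightComplex {e} := by
  refine le_antisymm (fun w hw => ?_) ((Submodule.span_singleton_le_iff_mem _ _).2 he)
  have hw1 := hw.1
  rw [L.fiber_eq_span he.1 h0] at hw1
  obtain ⟨c, rfl⟩ := Submodule.mem_span_singleton.1 hw1
  refine RightComplex.smul_mem_span h0 ?_
  rw [← he.2, ← map_smul, hw.2]

/-- `v ↦ v - (J v) i` maps `L` to the `i`-eigenspace of `J`. -/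
theorem sub_smul_mem_eigenFiber {p : M} {v : H2} (hv : v ∈ L.fiber p) :
    v - RightComplex.I • L.JExt p v ∈ L.eigenFiber p := by
  refine ⟨sub_mem hv (L.complex_smul_mem _ (L.JExt_mem hv)), ?_⟩
  rw [map_sub, L.JExt_complex_smul, L.JExt_JExt hv, smul_sub, RightComplex.I_smul_I_smul, smul_neg]
  abel

/-- The map `v ↦ v - (Jv)i` kills the vectors with `Jv = -vi`, but it cannot kill both `v` and `vj`:
with `x = Jv` this would give `v = xi` and `vj = xji = -xij = -vj`. -/
theorem exists_sub_smul_ne_zero {p : M} {v : H2} (hv : v ≠ 0) :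
    ∃ c : ℍ[ℝ]ᵐᵒᵖ, c • v - RightComplex.I • L.JExt p (c • v) ≠ 0 := by
  by_contra! h
  obtain ⟨k, hk⟩ := LineSubbundle.exists_coord_ne_zero hv
  have h1 := congrFun (h 1) k
  have h2 := congrFun (h (MulOpposite.op (⟨0, 0, 1, 0⟩ : ℍ[ℝ]))) k
  rw [one_smul] at h1
  rw [map_smul] at h2
  set i := RightComplex.toQuaternion RightComplex.I with hi
  set j : ℍ[ℝ] := ⟨0, 0, 1, 0⟩ with hj
  set x := L.JExt p v k with hx
  have h3 : v k = x * i := sub_eq_zero.1 h1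
  have h4 : v k * j = x * j * i := sub_eq_zero.1 h2
  have hij : j * i = -(i * j) := by
    have j1 : j.re = 0 := rfl
    have j2 : j.imI = 0 := rfl
    have j3 : j.imJ = 1 := rfl
    have j4 : j.imK = 0 := rfl
    ext <;> simp only [Quaternion.re_neg, Quaternion.imI_neg, Quaternion.imJ_neg,
      Quaternion.imK_neg, Quaternion.re_mul, Quaternion.imI_mul, Quaternion.imJ_mul,
      Quaternion.imK_mul, hi, RightComplex.re_toQuaternion_I, RightComplex.imI_toQuaternion_I,
      RightComplex.imJ_toQuaternion_I, RightComplex.imK_toQuaternion_I, j1, j2, j3, j4] <;>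
      norm_num
  have h5 : v k * j + v k * j = 0 := by
    nth_rw 1 [h4]
    rw [mul_assoc, hij, h3, mul_assoc, mul_neg, neg_add_cancel]
  have hj0 : j ≠ 0 := fun h => by simpa [hj] using congrArg QuaternionAlgebra.imJ h
  rw [← two_smul ℝ] at h5
  exact mul_ne_zero hk hj0 ((smul_eq_zero.1 h5).resolve_left two_ne_zero)

/-- The complex line subbundle of `L` on which `J` is the right multiplication by `i`. -/
noncomputable def eigenbundle : LineSubbundle RightComplex M where
  fiber := L.eigenFiber
  exists_frame p := by
    obtain ⟨U, hU, hp, σ, hσ, hspan⟩ := L.exists_frame p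
    obtain ⟨c, hc⟩ := L.exists_sub_smul_ne_zero (p := p) (hspan p hp).1
    have hψ : L.SmoothSectionOn U (fun q => c • σ q) := LineSubbundle.SmoothSectionOn.smul hσ c
    let τ : ∀ q, L.eigenFiber q := fun q =>
      ⟨_, L.sub_smul_mem_eigenFiber (c • σ q).2⟩
    have hτ : ContMDiffOn 𝓘(ℝ, ℂ) 𝓘(ℝ, H2) ∞ (fun q => (τ q : H2)) U := by
      have h1 := (smulCLM RightComplex.I).contDiff.contMDiff.comp_contMDiffOn (n := ∞)
        (L.J_smooth U _ hU hψ)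
      refine (ContMDiffOn.sub hψ h1).congr fun q hq => ?_
      simp only [τ, L.JExt_apply]
      rfl
    -- The section `τ` is nonzero at `p` by the choice of `c`, hence nearby, and a nonzero
    -- eigenvector spans the eigenspace over `ℂ`.
    have hne : ∀ᶠ q in nhds p, (τ q : H2) ≠ 0 :=
      (hτ.contMDiffAt (hU.mem_nhds hp)).continuousAt.eventually_ne hc
    obtain ⟨V, hV, hVo, hpV⟩ := eventually_nhds_iff.1 hne
    exact ⟨U ∩ V, hU.inter hVo, ⟨hp, hpV⟩, τ, hτ.mono Set.inter_subset_left, fun q hq =>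
      ⟨hV q hq.2, L.eigenFiber_eq_span (τ q).2 (hV q hq.2)⟩⟩

end ComplexQuaternionicLine

/-! ### Twistor projections -/

namespace LineSubbundle

theorem exists_ne_zero {R : Type} [Ring R] [Module R H2] (E : LineSubbundle R M) (p : M) :
    ∃ e : E.fiber p, (e : H2) ≠ 0 ∧ E.fiber p = Submodule.span R {(e : H2)} := by
  obtain ⟨U, _, hp, σ, _, hspan⟩ := E.exists_frame p
  exact ⟨σ p, hspan p hp⟩

variable (E : LineSubbundle RightComplex M)

/-- The inclusion of `E` in its twistor projection. -/
noncomputable def toTwistor {p : M} (v : E.fiber p) : E.twistorProjection.fiber p := E.incl v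

theorem J_toTwistor_eq {p : M} (v : E.fiber p) :
    E.twistorProjection.J p (E.toTwistor v) = E.toTwistor (RightComplex.I • v) :=
  E.twistorJ_incl v

theorem JExt_twistorProjection {p : M} {v : H2} (hv : v ∈ E.fiber p) :
    E.twistorProjection.JExt p v = RightComplex.I • v := by
  have h := E.twistorProjection.JExt_apply (E.toTwistor ⟨v, hv⟩)
  exact h.trans (congrArg Subtype.val (E.twistorJ_incl ⟨v, hv⟩))

/-- `E` lies in the eigenspace, which is itself only a complex line. -/
theorem eigenFiber_twistorProjection (p : M) :
    E.twistorProjection.eigenFiber p = E.fiber p := by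
  obtain ⟨e, he, hspan⟩ := E.exists_ne_zero p
  rw [hspan]
  exact E.twistorProjection.eigenFiber_eq_span
    ⟨E.mem_quaternionicSpan e, E.JExt_twistorProjection e.2⟩ he

/-- Quaternionic linear maps on `Eℍ` are determined by their restriction to `E`. -/
theorem linearMap_ext {p : M} {N : Type*} [AddCommGroup N] [Module ℍ[ℝ]ᵐᵒᵖ N]
    {f g : E.twistorProjection.fiber p →ₗ[ℍ[ℝ]ᵐᵒᵖ] N}
    (h : ∀ v : E.fiber p, f (E.toTwistor v) = g (E.toTwistor v)) : f = g := by
  obtain ⟨e, he, -⟩ := E.exists_ne_zero p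
  ext1 v
  obtain ⟨c, hc⟩ := Submodule.mem_span_singleton.1
    ((E.twistorProjection.fiber_eq_span (E.mem_quaternionicSpan e) he).le v.2)
  have hv' : v = c • E.toTwistor e := Subtype.ext hc.symm
  rw [hv', map_smul, map_smul]
  exact congrArg (c • ·) (h e)

/-- A nonzero eigenvector spans `L` over `ℍ`. Both complex structures are multiplication by `i` on
the eigenbundle, and a quaternionic linear map on its span is determined there. -/
theorem twistorProjection_eigenbundle (L : ComplexQuaternionicLine M) :
    L.eigenbundle.twistorProjection = L := by
  have hf : ∀ p, L.eigenbundle.twistorProjection.fiber p = L.fiber p := fun p => by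
    obtain ⟨e, he, -⟩ := L.eigenbundle.exists_ne_zero p
    rw [L.fiber_eq_span e.2.1 he]
    exact L.eigenbundle.twistorProjection.fiber_eq_span (L.eigenbundle.mem_quaternionicSpan e) he
  refine ComplexQuaternionicLine.ext_of_fiber hf fun p v hv hv' => ?_
  have h : (L.eigenbundle.twistorProjection.fiber p).subtype.comp
      (L.eigenbundle.twistorProjection.J p) =
        (L.JExt p).comp (L.eigenbundle.twistorProjection.fiber p).subtype :=
    L.eigenbundle.linearMap_ext fun w =>
      (congrArg Subtype.val (L.eigenbundle.twistorJ_incl w)).trans w.2.2.symm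
  exact (LinearMap.congr_fun h ⟨v, hv⟩).trans (L.JExt_apply ⟨v, hv'⟩)

/-- Inserting `vi` for `v` and using `i² = -1` turns one condition into the other. -/
theorem halfDelta_eq_zero_iff : (∀ p : M, E.halfDelta p = 0) ↔ E.IsHolomorphicCurve := by
  have key : ∀ (p : M) (X : TSpace p) (v : E.fiber p), E.halfDelta p X v =
      (1 / 2 : ℝ) • (E.delta p X v + E.delta p (rot p X) (RightComplex.I • v)) :=
    fun p X v => rfl
  have hI : ∀ (p : M) (v : E.fiber p), RightComplex.I • RightComplex.I • v = -v := fun p v => by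
    rw [smul_smul, RightComplex.I_mul_I, neg_one_smul]
  constructor
  · intro h p X v
    have h1 := key p X (RightComplex.I • v)
    rw [h p, hI, map_neg] at h1
    have h2 := (smul_eq_zero.1 h1.symm).resolve_left (by norm_num)
    exact (add_neg_eq_zero.1 h2).symm
  · intro h p
    ext1 X
    ext1 v
    rw [key, h p X, hI, map_neg, add_neg_cancel, smul_zero]
    rfl

variable {E} {U : Set M} {φ : ∀ q, E.fiber q} {p : M}

theorem SmoothSectionOn.toTwistor (hφ : E.SmoothSectionOn U φ) :
    E.twistorProjection.SmoothSectionOn U (fun q => E.toTwistor (φ q)) := hφ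

theorem J_toTwistor (v : E.fiber p) :
    E.twistorProjection.J p (E.toTwistor v) =
      MulOpposite.op (RightComplex.toQuaternion RightComplex.I) • E.toTwistor v :=
  (E.twistorJ_incl v).trans (Subtype.ext rfl)

/-- On `E`, `J` is multiplication by `i`, so `D̃φ = ½(dφ + *d(φi))`; reducing modulo `E` gives the
claim. This links `E` to the operator of its twistor projection. -/
theorem halfDelta_apply_section (hU : IsOpen U) (hφ : E.SmoothSectionOn U φ) (hp : p ∈ U)
    (X : TSpace p) : E.halfDelta p X (φ p) =
      (E.fiber p).mkQ (E.twistorProjection.dTilde (fun q => E.toTwistor (φ q)) p X) := by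
  have h1 := E.delta_apply hU hφ hp X
  have h2 := E.delta_apply hU (hφ.smul RightComplex.I) hp (rot p X)
  have h3 : E.twistorProjection.dTilde (fun q => E.toTwistor (φ q)) p X =
      (1 / 2 : ℝ) • (diff (fun q => (φ q : H2)) p X +
        diff (fun q => ((RightComplex.I • φ q : E.fiber q) : H2)) p (rot p X)) := by
    rw [ComplexQuaternionicLine.dTilde_apply]
    simp only [J_toTwistor]
    rfl
  rw [h3]
  change (1 / 2 : ℝ) • (E.delta p X (φ p) + E.delta p (rot p X) (RightComplex.I • φ p)) = _
  rw [h1, h2, ← map_add]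
  rfl

/-- Put `u = D̃φ`. Since `D̃` commutes with constant scalars, `D̃Jφ = ui` and `A_Lφ = ½(u + (Ju)i)`.
The difference `u - A_Lφ = ½(u - (Ju)i)` is in the eigenspace `E`. -/
theorem halfDelta_eq_mkQ (hL : E.twistorProjection.IsHolomorphicCurve)
    {A : E.twistorProjection.EndForm} (hA : E.twistorProjection.IsAL A) (p : M) (X : TSpace p)
    (v : E.fiber p) : E.halfDelta p X v = (E.fiber p).mkQ (A p X (E.toTwistor v) : H2) := by
  rw [ComplexQuaternionicLine.isAL_iff hL] at hA
  obtain ⟨U, φ, hU, hp, hφ, rfl⟩ := E.exists_section p v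
  rw [halfDelta_apply_section hU hφ hp, hA U _ hU hφ.toTwistor p hp X]
  set u := E.twistorProjection.dTilde (fun q => E.toTwistor (φ q)) p X with hu
  have hum : u ∈ E.twistorProjection.fiber p :=
    ComplexQuaternionicLine.dTilde_mem hL hU hφ.toTwistor hp X
  have h1 : E.twistorProjection.dTilde
      (fun q => E.twistorProjection.J q (E.toTwistor (φ q))) p X = RightComplex.I • u := by
    simp only [J_toTwistor]
    exact ComplexQuaternionicLine.dTilde_smul hU hφ.toTwistor hp _ X
  rw [ComplexQuaternionicLine.hopfOp, h1, ← hu, ComplexQuaternionicLine.JExt_complex_smul]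
  refine (Submodule.Quotient.eq _).2 ?_
  have h2 : u - (1 / 2 : ℝ) • (u + RightComplex.I • E.twistorProjection.JExt p u) =
      (1 / 2 : ℝ) • (u - RightComplex.I • E.twistorProjection.JExt p u) := by
    rw [smul_add, smul_sub]
    nth_rw 1 [show u = (1 / 2 : ℝ) • u + (1 / 2 : ℝ) • u by rw [← add_smul]; norm_num]
    abel
  rw [h2, ← E.eigenFiber_twistorProjection p]
  exact ((E.twistorProjection.eigenFiber p).restrictScalars ℝ).smul_mem _
    (E.twistorProjection.sub_smul_mem_eigenFiber hum)

/-- If `π_E A_L` vanishes on `E`, then for `v` in `E` the vector `A_L v` is in `E`, so `J A_L v =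
(A_L v)i`. But `(A_L v)i = A_L J v = -J A_L v`, hence `A_L v = 0`. -/
theorem halfDelta_eq_zero_iff_hopf [IsManifold 𝓘(ℂ) ω M]
    (hL : E.twistorProjection.IsHolomorphicCurve)
    {A : E.twistorProjection.EndForm} (hA : E.twistorProjection.IsAL A) :
    (∀ p : M, E.halfDelta p = 0) ↔ ∀ p : M, A p = 0 := by
  refine ⟨fun h p => ?_, fun h p => ?_⟩
  · ext1 X
    refine E.linearMap_ext fun v => Subtype.ext ?_
    have h1 := halfDelta_eq_mkQ hL hA p X v
    rw [h p] at h1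
    have h2 : (A p X (E.toTwistor v) : H2) ∈ E.fiber p := (Submodule.Quotient.mk_eq_zero _).1 h1.symm
    have h3 := (hA.isKEndMinus hL).anti p X (E.toTwistor v)
    rw [J_toTwistor, map_smul] at h3
    have h4 : RightComplex.I • (A p X (E.toTwistor v) : H2) =
        -(E.twistorProjection.J p (A p X (E.toTwistor v)) : H2) := congrArg Subtype.val h3
    rw [← E.twistorProjection.JExt_apply, E.JExt_twistorProjection h2] at h4
    have h5 : RightComplex.I • (A p X (E.toTwistor v) : H2) = 0 := by
      rw [eq_neg_iff_add_eq_zero, ← two_smul ℝ] at h4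
      exact (smul_eq_zero.1 h4).resolve_left two_ne_zero
    exact (smul_eq_zero.1 h5).resolve_left Complex.I_ne_zero
  · ext1 X
    ext1 v
    rw [halfDelta_eq_mkQ hL hA, h p]
    exact map_zero _

/-- As `E ⊂ L`, the right side says that `D̃φ` is in `L` for sections `φ` of `E`, that is, `*δ_L J =
-δ_L` on `E`. -/
theorem isHolomorphicCurve_twistorProjection_iff (E : LineSubbundle RightComplex M) :
    E.twistorProjection.IsHolomorphicCurve ↔
      ∀ (p : M) (X : TSpace p) (v : E.fiber p),
        ∃ w ∈ E.twistorProjection.fiber p, E.halfDelta p X v = (E.fiber p).mkQ w := by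
  constructor
  · intro hL p X v
    obtain ⟨U, φ, hU, hp, hφ, rfl⟩ := E.exists_section p v
    exact ⟨_, ComplexQuaternionicLine.dTilde_mem hL hU hφ.toTwistor hp X,
      halfDelta_apply_section hU hφ hp X⟩
  · intro h p X
    have key : ∀ v : E.fiber p, E.twistorProjection.delta p (rot p X)
        (E.twistorProjection.J p (E.toTwistor v)) = -E.twistorProjection.delta p X (E.toTwistor v) := by
      intro v
      obtain ⟨w, hw, hw'⟩ := h p X v
      obtain ⟨U, φ, hU, hp, hφ, rfl⟩ := E.exists_section p v
      rw [halfDelta_apply_section hU hφ hp] at hw'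
      have h1 : E.twistorProjection.dTilde (fun q => E.toTwistor (φ q)) p X - w ∈
          E.twistorProjection.fiber p := E.mem_quaternionicSpan ⟨_, (Submodule.Quotient.eq _).1 hw'⟩
      have h2 : E.twistorProjection.dTilde (fun q => E.toTwistor (φ q)) p X ∈
          E.twistorProjection.fiber p := (Submodule.sub_mem_iff_left _ hw).1 h1
      have h3 := ((E.twistorProjection.fiber p).restrictScalars ℝ).smul_mem 2 h2
      rw [ComplexQuaternionicLine.dTilde_apply, smul_smul] at h3
      norm_num at h3
      have h4 := (Submodule.Quotient.mk_eq_zero _).2 h3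
      have e1 := E.twistorProjection.delta_apply hU hφ.toTwistor hp X
      have e2 := E.twistorProjection.delta_apply hU
        (E.twistorProjection.J_smooth U _ hU hφ.toTwistor) hp (rot p X)
      rw [e1, e2, eq_neg_iff_add_eq_zero, add_comm, ← map_add]
      exact h4
    -- Applying `key` to `vi` gives `*δ_L = δ_L J` on `E`; quaternionic linearity extends it to `L`.
    have hlin : E.twistorProjection.delta p (rot p X) =
        (E.twistorProjection.delta p X).comp (E.twistorProjection.J p) :=
      E.linearMap_ext fun v => by
        have h1 := key (RightComplex.I • v)
        rw [← E.J_toTwistor_eq, E.twistorProjection.J_sq, map_neg, neg_inj] at h1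
        exact h1
    exact fun v => LinearMap.congr_fun hlin v

end LineSubbundle

end

/-! ### The Hopf field of a complex structure on `M × ℍ²` -/

section MeanCurvatureSphere

variable {M : Type*} [TopologicalSpace M] [ChartedSpace ℂ M]

namespace IsComplexStructure

variable {S : M → (H2 →L[ℝ] H2)} (hS : IsComplexStructure S)

theorem mdifferentiableAt (hS : IsComplexStructure S) (p : M) :
    MDifferentiableAt 𝓘(ℝ, ℂ) 𝓘(ℝ, H2 →L[ℝ] H2) S p :=
  hS.smooth.contMDiffAt.mdifferentiableAt (by simp)

/-- For fixed `c` and `v`, both sides of `S(vc) = (Sv)c` are linear in `S`, so the identity can be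
differentiated. -/
theorem diff_smul (hS : IsComplexStructure S) (p : M) (X : TSpace p) (c : ℍ[ℝ]ᵐᵒᵖ) (v : H2) :
    diff S p X (c • v) = c • diff S p X v := by
  have h1 := diff_clm_comp (ContinuousLinearMap.apply ℝ H2 (c • v)) (hS.mdifferentiableAt p) X
  have h2 := diff_clm_comp ((smulCLM c).comp (ContinuousLinearMap.apply ℝ H2 v))
    (hS.mdifferentiableAt p) X
  have h3 : (fun q => ContinuousLinearMap.apply ℝ H2 (c • v) (S q)) =
      fun q => ((smulCLM c).comp (ContinuousLinearMap.apply ℝ H2 v)) (S q) :=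
    funext fun q => hS.linear q c v
  rw [h3, h2] at h1
  exact h1.symm

/-- Differentiating `S² = -1`. -/
theorem diff_anti (hS : IsComplexStructure S) (p : M) (X : TSpace p) :
    (diff S p X).comp (S p) = -(S p).comp (diff S p X) := by
  have h1 := diff_bilinear (ContinuousLinearMap.compL ℝ H2 H2 H2) (hS.mdifferentiableAt p)
    (hS.mdifferentiableAt p) X
  have h2 : (fun q => ContinuousLinearMap.compL ℝ H2 H2 H2 (S q) (S q)) =
      fun _ => -ContinuousLinearMap.id ℝ H2 := by
    funext q
    ext1 v
    exact hS.sq q v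
  have h3 : diff (fun _ : M => -ContinuousLinearMap.id ℝ H2) p X = 0 :=
    diff_eq_of_hasMFDerivAt (hasMFDerivAt_const _ _) X
  rw [h2, h3] at h1
  exact eq_neg_of_add_eq_zero_left h1.symm

theorem comp_self (hS : IsComplexStructure S) (p : M) (T : H2 →L[ℝ] H2) :
    (S p).comp ((S p).comp T) = -T := by
  ext1 v
  exact hS.sq p (T v)

/-- `S² = -1` and `** = -1` give `*A = ¼(S*dS - dS) = SA`. Differentiating `S² = -1` shows that
`dS`, and so `A`, anticommutes with `S`. -/
theorem isKEndMinusH_hopfA [IsManifold 𝓘(ℂ) ω M] (hS : IsComplexStructure S) :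
    IsKEndMinusH S (hopfA S) := by
  have : IsManifold 𝓘(ℝ, ℂ) ∞ M := isManifold_real
  have key : ∀ p X, hopfA S p X =
      (1 / 4 : ℝ) • ((S p).comp (diff S p X) + diff S p (rot p X)) := fun _ _ => rfl
  refine ⟨fun p₀ w => ?_, fun p X c v => ?_, fun p X => ?_, fun p X => ?_⟩
  · have h1 := contMDiffOn_diff_coordField isOpen_univ hS.smooth.contMDiffOn p₀ w
    have h2 := contMDiffOn_diff_coordField isOpen_univ hS.smooth.contMDiffOn p₀ (Complex.I * w)
    have h3 := ContMDiffOn.clm_comp (hS.smooth.contMDiffOn (s := Set.univ ∩ (chartAt ℂ p₀).source))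
      h1
    refine (contMDiffOn_real_smul (1 / 4) (h3.add h2)).congr fun q hq => ?_
    rw [key, rot_coordField p₀ w hq.2]
    rfl
  · have h1 := hS.diff_smul p X c v
    have h2 := hS.diff_smul p (rot p X) c v
    rw [key]
    change (1 / 4 : ℝ) • (S p (diff S p X (c • v)) + diff S p (rot p X) (c • v)) =
      c • (1 / 4 : ℝ) • (S p (diff S p X v) + diff S p (rot p X) v)
    rw [h1, h2, hS.linear, smul_comm c (1 / 4 : ℝ), smul_add c]
  · rw [key, key, rot_rot, map_neg, ContinuousLinearMap.comp_smul, ContinuousLinearMap.comp_add,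
      hS.comp_self, add_comm]
  · rw [key, ContinuousLinearMap.smul_comp, ContinuousLinearMap.add_comp,
      ContinuousLinearMap.comp_assoc, hS.diff_anti, hS.diff_anti, ContinuousLinearMap.comp_smul,
      ContinuousLinearMap.comp_add, ContinuousLinearMap.comp_neg, ← neg_add]
    exact smul_neg _ _

end IsComplexStructure

/-- If `J` is the restriction of a complex structure `S` on `M × ℍ²`, then `A_L` is the
restriction of the Hopf field of `S`. -/
theorem ComplexQuaternionicLine.IsAL.hopfA_apply {L : ComplexQuaternionicLine M}
    {S : M → (H2 →L[ℝ] H2)} (hL : L.IsHolomorphicCurve) (hS : IsComplexStructure S)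
    (hJ : ∀ (p : M) (v : L.fiber p), (L.J p v : H2) = S p v) {A : L.EndForm} (hA : L.IsAL A)
    (p : M) (X : TSpace p) (v : L.fiber p) : hopfA S p X v = (A p X v : H2) := by
  obtain ⟨U, ψ, hU, hp, hψ, rfl⟩ := L.exists_section p v
  have hd := LineSubbundle.mdifferentiableAt_of_section hU hψ hp
  have hJd : ∀ Y, diff (fun q => (L.J q (ψ q) : H2)) p Y =
      diff S p Y (ψ p) + S p (diff (fun q => (ψ q : H2)) p Y) := fun Y => by
    simp only [hJ]
    exact diff_bilinear (ContinuousLinearMap.id ℝ (H2 →L[ℝ] H2)) (hS.mdifferentiableAt p) hd Y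
  have hm := dTilde_mem hL hU hψ hp (rot p X)
  have hJE : L.JExt p (L.dTilde ψ p (rot p X)) = S p (L.dTilde ψ p (rot p X)) := by
    rw [L.JExt_apply ⟨_, hm⟩, hJ]
  rw [(isAL_iff hL A).1 hA U ψ hU hψ p hp X, hopfOp_eq_sub hU hψ hp, hJE, dTilde_apply,
    dTilde_apply, hJd, hJd, rot_rot]
  change (1 / 4 : ℝ) • (S p (diff S p X (ψ p)) + diff S p (rot p X) (ψ p)) = _
  -- Here `D̃ψ = ½(dψ + *dS ψ + S*dψ)` and `S*D̃ψ = ½(S*dψ - S dS ψ + dψ)`; in half the difference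
  -- only `¼(S dS + *dS)ψ` survives.
  simp only [map_neg, map_smul, map_add, hS.sq, neg_apply]
  module

end MeanCurvatureSphere

theorem mainTheorem5 {M : Type*} [TopologicalSpace M] [T2Space M] [ChartedSpace ℂ M]
    [IsManifold 𝓘(ℂ) ω M] :
    -- (i) the twistor projection of `E` is holomorphic iff `½ (δ_E + *δ_E J_E)` has values
    -- in `Hom(E, L/E)`
    (∀ E : LineSubbundle RightComplex M,
      E.twistorProjection.IsHolomorphicCurve ↔
        ∀ (p : M) (X : TSpace p) (v : E.fiber p),
          ∃ w ∈ E.twistorProjection.fiber p, E.halfDelta p X v = (E.fiber p).mkQ w) ∧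
    -- `D̃ : Γ(L) → Ω¹(L)`, and `A_L` exists, is the `(1,0)`-part of `D̃`, and is in `Γ(K End₋(L))`
    (∀ L : ComplexQuaternionicLine M, L.IsHolomorphicCurve →
      (∀ (U : Set M) (ψ : ∀ q, L.fiber q), IsOpen U → L.SmoothSectionOn U ψ →
        (∀ p ∈ U, ∀ X : TSpace p, L.dTilde ψ p X ∈ L.fiber p) ∧ SmoothFormOn U (L.dTilde ψ)) ∧
      (∃! A_L : L.EndForm, L.IsAL A_L) ∧
      ∀ A_L : L.EndForm, L.IsAL A_L → L.IsOneZeroPart A_L ∧ L.IsKEndMinus A_L) ∧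
    -- (ii)
    (∀ E : LineSubbundle RightComplex M, E.twistorProjection.IsHolomorphicCurve →
      ∀ A_L : E.twistorProjection.EndForm, E.twistorProjection.IsAL A_L →
        (∀ (p : M) (X : TSpace p) (v : E.fiber p),
          E.halfDelta p X v = (E.fiber p).mkQ (A_L p X (E.incl v) : H2)) ∧
        ((∀ p : M, E.halfDelta p = 0) ↔ ∀ p : M, A_L p = 0)) ∧
    -- twistor projections of holomorphic curves in `ℂP³` are exactly the holomorphic curves in
    -- `ℍP¹` with `A_L = 0`
    (∀ L : ComplexQuaternionicLine M,
      (∃ E : LineSubbundle RightComplex M, E.IsHolomorphicCurve ∧ E.twistorProjection = L) ↔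
        L.IsHolomorphicCurve ∧ ∃ A_L : L.EndForm, L.IsAL A_L ∧ ∀ p : M, A_L p = 0) ∧
    -- (iii)
    (∀ (L : ComplexQuaternionicLine M) (S : M → (H2 →L[ℝ] H2)),
      L.IsHolomorphicCurve → L.IsImmersed → IsMeanCurvatureSphere L.toLineSubbundle S →
      (∀ (p : M) (v : L.fiber p), (L.J p v : H2) = S p v) →
        IsKEndMinusH S (hopfA S) ∧
        ∀ A_L : L.EndForm, L.IsAL A_L →
          ∀ (p : M) (X : TSpace p) (v : L.fiber p), hopfA S p X v = (A_L p X v : H2)) := by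
  refine ⟨LineSubbundle.isHolomorphicCurve_twistorProjection_iff, fun L hL => ⟨fun U ψ hU hψ =>
    ⟨fun p hp X => ComplexQuaternionicLine.dTilde_mem hL hU hψ hp X,
      ComplexQuaternionicLine.smoothFormOn_dTilde hU hψ⟩, ?_,
    fun A hA => ⟨hA.isOneZeroPart hL, hA.isKEndMinus hL⟩⟩,
    fun E hE A hA => ⟨LineSubbundle.halfDelta_eq_mkQ hE hA,
      LineSubbundle.halfDelta_eq_zero_iff_hopf hE hA⟩, fun L => ⟨?_, ?_⟩,
    fun L S hL _ hS hJ => ⟨hS.toIsComplexStructure.isKEndMinusH_hopfA,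
      fun A hA => hA.hopfA_apply hL hS.toIsComplexStructure hJ⟩⟩
  · obtain ⟨A, hA⟩ := ComplexQuaternionicLine.exists_isAL hL
    exact ⟨A, hA, fun B hB => ComplexQuaternionicLine.isAL_unique hL hB hA⟩
  · rintro ⟨E, hE, rfl⟩
    have h0 := E.halfDelta_eq_zero_iff.2 hE
    have hL : E.twistorProjection.IsHolomorphicCurve :=
      E.isHolomorphicCurve_twistorProjection_iff.2 fun p X v =>
        ⟨0, zero_mem _, by rw [h0 p, map_zero]; rfl⟩
    obtain ⟨A, hA⟩ := ComplexQuaternionicLine.exists_isAL hL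
    exact ⟨hL, A, hA, (LineSubbundle.halfDelta_eq_zero_iff_hopf hL hA).1 h0⟩
  · rintro ⟨hL, A, hA, h0⟩
    have hE := LineSubbundle.twistorProjection_eigenbundle L
    refine ⟨L.eigenbundle, L.eigenbundle.halfDelta_eq_zero_iff.1 ?_, hE⟩
    -- The type of `A` involves `L`. Once `E` is an arbitrary bundle with twistor projection `L`,
    -- the equation can be substituted for `L`.
    generalize L.eigenbundle = E at hE
    subst hE
    exact (LineSubbundle.halfDelta_eq_zero_iff_hopf hL hA).2 h0
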